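/- **Setting.** Let $l,n\ge 0$ be integers and let a fully connected network have layer widths $d_0,\dots,d_{l+1}$ with $d_{l+1}=d_0=m$, and twice continuously differentiable activation maps $g^{(1)},\dots,g^{(l+1)}$ (scalar functions acting entrywise, or more generally $C^2$ maps $g^{(j)}:\mathbb R^{d_j}\to\mathbb R^{d_j}$). Let $X=[x_1,\dots,x_n]\in\mathbb R^{m\times n}$, let $\Omega$ be a set of (observed) positions with $0$-$1$ mask $N$, and let $\theta=(W^{(1)},\dots,W^{(l+1)},b^{(1)},\dots,b^{(l+1)})$, $z_q^{(0)}=x_q$, $z_q^{(j)}=g^{(j)}(W^{(j)}z_q^{(j-1)}+b^{(j)})$, $\widehat X=[z_1^{(l+1)},\dots,z_n^{(l+1)}]$. For fixed $\lambda,\mu_{h^{(i)}},\mu_{v^{(j)}},M>0$ and $\alpha_i,\beta_j\ge 0$ put $$g(h,V,\theta)=\|N\odot(X-\widehat X)\|_F^2+\lambda\sum_{j=1}^{l+1}\|W^{(j)}\|_F^2+\sum_{q=1}^n\sum_{i=1}^l\tfrac1{2\mu_{h^{(i)}}}\|z_q^{(i)}-h_q^{(i)}\|^2+\sum_{j=1}^{l+1}\tfrac1{2\mu_{v^{(j)}}}\|W^{(j)}-V^{(j)}\|_F^2,$$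 $r_h(h_q^{(i)})=\alpha_i\|h_q^{(i)}\|_1$, $r_v(V^{(j)})=\beta_j\|V^{(j)}\|_*$ (nuclear norm), $r_\theta(\theta)=0$ if $\|\theta\|_\infty\le M$ and $+\infty$ otherwise, and $$Q(h,V,\theta)=g(h,V,\theta)+\sum_{q,i}r_h(h_q^{(i)})+\sum_j r_v(V^{(j)})+r_\theta(\theta).$$ Write $\mathrm{Prox}_{s,r}(x)=\arg\min_u\, r(u)+\frac1{2s}\|u-x\|^2$. **Algorithm.** Fix $\gamma>1$ and $\delta_{\max}<1$. Starting from arbitrary $h_0,V_0,\theta_0$ and $\theta_{-1}=\theta_0$, epoch $k=1,2,\dots$ performs, for $q=1,\dots,n$ and $i=1,\dots,l$ in lexicographic order, then for $j=1,\dots,l+1$ in order, and finally for $\theta$, $$h_{q,k}^{(i)}=\mathrm{Prox}_{\mu_{h^{(i)},k},\,r_h}\bigl(h_{q,k-1}^{(i)}-\mu_{h^{(i)},k}\nabla_{h_q^{(i)}}g\bigr),\qquad V_k^{(j)}=\mathrm{Prox}_{\mu_{v^{(j)},k},\,r_v}\bigl(V_{k-1}^{(j)}-\mu_{v^{(j)},k}\nabla_{V^{(j)}}g\bigr),$$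 $$\widehat\theta_{k-1}=\theta_{k-1}+\omega_{\theta,k}(\theta_{k-1}-\theta_{k-2}),\qquad \theta_k=\mathrm{Prox}_{\mu_{\theta,k},\,r_\theta}\bigl(\widehat\theta_{k-1}-\mu_{\theta,k}\nabla_\theta g(h_k,V_k,\widehat\theta_{k-1})\bigr),$$ where the first two gradients are taken at the most recent values of all the blocks ($\theta=\theta_{k-1}$). The step sizes satisfy $\mu_{h^{(i)}}^{\min}\le\mu_{h^{(i)},k}\le\mu_{h^{(i)}}$, $\mu_{v^{(j)}}^{\min}\le\mu_{v^{(j)},k}\le\mu_{v^{(j)}}$ and $\mu_\theta^{\min}\le\mu_{\theta,k}=\frac1{\gamma L_{\theta,k}}\le\mu_\theta^{\max}$ with positive constants $\mu^{\min}$ and finite $\mu_\theta^{\max}$, where $L_{\theta,k}>0$ for all $k\ge0$ and, for $k\ge1$, $L_{\theta,k}$ is a Lipschitz constant of $\nabla_\theta g(h_k,V_k,\cdot)$ on $\{\|\theta\|_\infty\le M\}\cup\{\widehat\theta_{k-1}\}$; the extrapolation weights satisfy $0\le\omega_{\theta,k}\le\frac{\gamma-1}{2(\gamma+1)}\sqrt{\delta_k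 L_{\theta,k-1}/L_{\theta,k}}$ with $0\le\delta_k\le\delta_{\max}$. **Theorem 1 (Subsequence convergence).** Let $\{(h_k,V_k,\theta_k)\}_{k\ge0}$ be a bounded infinite sequence generated in this way. Then: (a) The sequence has a (finite) limit point. (b) If a subsequence indexed by $\mathcal I$ converges to $(\bar h,\bar V,\bar\theta)$, then, as $\mathcal I\ni k\to\infty$, $r_h(h_{q,k}^{(i)})\to r_h(\bar h_q^{(i)})$ for all $q,i$, $r_v(V_k^{(j)})\to r_v(\bar V^{(j)})$ for all $j$, and $r_\theta(\theta_k)\to r_\theta(\bar\theta)$. (c) Every limit point of the sequence is a critical point of $Q$, i.e. $0$ belongs to the limiting subdifferential of $Q$ there. (d) If a subsequence indexed by $\mathcal I$ converges to $(\bar h,\bar V,\bar\theta)$, then $Q(h_k,V_k,\theta_k)\to Q(\bar h,\bar V,\bar\theta)$ as $\mathcal I\ni k\to\infty$. -/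

import Mathlib

open Filter Topology

noncomputable section

namespace DNNNSR

/-! ### Proximal operator, limiting subdifferential, critical points -/

section Variational

variable {E : Type*} [NormedAddCommGroup E] [InnerProductSpace ℝ E]

/-- `y` is a value at `x` of the proximal operator of `r` with step size `s`:
`y ∈ argmin_u  r u + ‖u - x‖² / (2 s)`. -/
def IsProx (r : E → EReal) (s : ℝ) (x y : E) : Prop :=
  ∀ u : E, r y + ((‖y - x‖ ^ 2 / (2 * s) : ℝ) : EReal)
    ≤ r u + ((‖u - x‖ ^ 2 / (2 * s) : ℝ) : EReal)

/-- Fréchet (regular) subdifferential of `f` at `x`: `f x` is finite and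
`liminf_{y → x} (f y - f x - ⟪v, y - x⟫) / ‖y - x‖ ≥ 0`. -/
def frechetSubdiff (f : E → EReal) (x : E) : Set E :=
  {v | f x ≠ ⊤ ∧ f x ≠ ⊥ ∧ ∀ ε : ℝ, 0 < ε → ∀ᶠ y in 𝓝 x,
    f x + ((inner ℝ v (y - x) - ε * ‖y - x‖ : ℝ) : EReal) ≤ f y}

/-- Limiting (Mordukhovich) subdifferential of `f` at `x`. -/
def limitingSubdiff (f : E → EReal) (x : E) : Set E :=
  {v | f x ≠ ⊤ ∧ f x ≠ ⊥ ∧ ∃ (xs vs : ℕ → E),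
    Tendsto xs atTop (𝓝 x) ∧ Tendsto (fun k => f (xs k)) atTop (𝓝 (f x)) ∧
    (∀ k, vs k ∈ frechetSubdiff f (xs k)) ∧ Tendsto vs atTop (𝓝 v)}

/-- Critical point: `0` belongs to the limiting subdifferential. -/
def IsCriticalPt (f : E → EReal) (x : E) : Prop :=
  (0 : E) ∈ limitingSubdiff f x

end Variational

/-! ### Spaces of variables -/

/-- `ℝ^a` with the Euclidean norm. -/
abbrev Vec (a : ℕ) : Type := EuclideanSpace ℝ (Fin a)

/-- `ℝ^{a × b}` with the Frobenius norm and inner product. -/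
abbrev Mat (a b : ℕ) : Type := EuclideanSpace ℝ (Fin a × Fin b)

/-- The nuclear norm: the sum of the singular values of the matrix (those with index at least
the number of columns vanish). -/
def nuclearNorm {a b : ℕ} (A : Mat a b) : ℝ :=
  ∑ i ∈ Finset.range b,
    (Matrix.toEuclideanLin (Matrix.of fun (r : Fin a) (c : Fin b) => A (r, c))).singularValues i

section Spaces

variable (l n : ℕ) (d : Fin (l + 2) → ℕ)

/-- The slack variables `h_q^{(i)}`, `q = 1..n`, `i = 1..l`; layer `0` is the input, so the
`i`-th hidden layer (`i : Fin l`, counted from `0`) has width `d i.castSucc.succ`. -/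
abbrev HSpace : Type :=
  PiLp 2 fun _ : Fin n => PiLp 2 fun i : Fin l => Vec (d i.castSucc.succ)

/-- One matrix of size `d_{j+1} × d_j` for each of the `l + 1` layers. -/
abbrev VSpace : Type :=
  PiLp 2 fun j : Fin (l + 1) => Mat (d j.succ) (d j.castSucc)

/-- The parameter vector `θ = (W, b)`, with its Euclidean norm. -/
abbrev ThetaSpace : Type :=
  WithLp 2 (VSpace l d × PiLp 2 fun j : Fin (l + 1) => Vec (d j.succ))

/-- All variables `(h, V, θ)`. -/
abbrev State : Type :=
  WithLp 2 (HSpace l n d × WithLp 2 (VSpace l d × ThetaSpace l d))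

end Spaces

section Model

variable {l n : ℕ} {d : Fin (l + 2) → ℕ}

/-- The block `h_q^{(i)}` of a state. -/
def State.h (x : State l n d) (q : Fin n) (i : Fin l) : Vec (d i.castSucc.succ) := x.fst q i

/-- The block `V^{(j)}` of a state. -/
def State.V (x : State l n d) (j : Fin (l + 1)) : Mat (d j.succ) (d j.castSucc) := x.snd.fst j

/-- The block `θ` of a state. -/
def State.θ (x : State l n d) : ThetaSpace l d := x.snd.snd

/-- The data of the nonlinear matrix completion model: a fully connected network with `l` hidden
layers of widths `d`, as many output as input neurons, and twice continuously differentiable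
activation maps (a scalar activation function acts entrywise); the data matrix `X`, whose `n`
columns are the inputs, with the set `Ω` of observed entries; and the weights. -/
structure Model (l n : ℕ) (d : Fin (l + 2) → ℕ) where
  hio : d (Fin.last (l + 1)) = d 0
  X : Matrix (Fin (d 0)) (Fin n) ℝ
  Ω : Finset (Fin (d 0) × Fin n)
  act : ∀ j : Fin (l + 1), Vec (d j.succ) → Vec (d j.succ)
  act_contDiff : ∀ j, ContDiff ℝ 2 (act j)
  lam : ℝ
  lam_pos : 0 < lam
  α : Fin l → ℝ
  α_nonneg : ∀ i, 0 ≤ α i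
  β : Fin (l + 1) → ℝ
  β_nonneg : ∀ j, 0 ≤ β j
  μh : Fin l → ℝ
  μh_pos : ∀ i, 0 < μh i
  μv : Fin (l + 1) → ℝ
  μv_pos : ∀ j, 0 < μv j
  M : ℝ
  M_pos : 0 < M

namespace Model

variable (P : Model l n d)

/-- The `q`-th column of `X`. -/
def input (q : Fin n) : Vec (d 0) := WithLp.toLp 2 fun r => P.X r q

/-- Output of layer `i` of the network on input `x` (layer `0` is the input itself):
`z^{(j+1)} = act_j (W_j z^{(j)} + b_j)`. -/
def layer (θ : ThetaSpace l d) (x : Vec (d 0)) (i : Fin (l + 2)) : Vec (d i) :=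
  Fin.induction (motive := fun i => Vec (d i)) x
    (fun j z => P.act j (WithLp.toLp 2 fun r => (∑ c, θ.fst j (r, c) * z c) + θ.snd j r)) i

/-- Output `z_q^{(i)}` of the `i`-th hidden layer on the `q`-th column. -/
def z (θ : ThetaSpace l d) (q : Fin n) (i : Fin l) : Vec (d i.castSucc.succ) :=
  P.layer θ (P.input q) i.castSucc.succ

/-- The entry of the network output `X̂` in row `r`, column `q`. -/
def xhat (θ : ThetaSpace l d) (r : Fin (d 0)) (q : Fin n) : ℝ :=
  P.layer θ (P.input q) (Fin.last (l + 1)) (Fin.cast P.hio.symm r)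

/-- `‖N ⊙ (X - X̂)‖_F² + λ ∑_j ‖W^{(j)}‖_F²`, with `N` the 0-1 mask of `Ω`. -/
def loss (θ : ThetaSpace l d) : ℝ :=
  (∑ p ∈ P.Ω, (P.X p.1 p.2 - P.xhat θ p.1 p.2) ^ 2) + P.lam * ∑ j, ‖θ.fst j‖ ^ 2

/-- The smooth part of the objective. -/
def g (h : ∀ (_ : Fin n) (i : Fin l), Vec (d i.castSucc.succ))
    (V : ∀ j : Fin (l + 1), Mat (d j.succ) (d j.castSucc)) (θ : ThetaSpace l d) : ℝ :=
  P.loss θ + (∑ q, ∑ i, 1 / (2 * P.μh i) * ‖P.z θ q i - h q i‖ ^ 2)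
    + ∑ j, 1 / (2 * P.μv j) * ‖θ.fst j - V j‖ ^ 2

/-- `r_h(y) = α_i ‖y‖₁` for the block of hidden layer `i`. -/
def rh (i : Fin l) (y : Vec (d i.castSucc.succ)) : ℝ := P.α i * ∑ a, |y a|

/-- `r_v(Y) = β_j ‖Y‖_*` for layer `j`. -/
def rv (j : Fin (l + 1)) (Y : Mat (d j.succ) (d j.castSucc)) : ℝ := P.β j * nuclearNorm Y

/-- The box `‖θ‖_∞ ≤ M`. -/
def box : Set (ThetaSpace l d) :=
  {θ | (∀ j e, |θ.fst j e| ≤ P.M) ∧ (∀ j a, |θ.snd j a| ≤ P.M)}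

open Classical in
/-- `r_θ`: zero if `‖θ‖_∞ ≤ M` and `+∞` otherwise. -/
def rθ (θ : ThetaSpace l d) : EReal := if θ ∈ P.box then 0 else ⊤

/-- The objective `Q = g + ∑ r_h + ∑ r_v + r_θ`. -/
def Q (x : State l n d) : EReal :=
  ((P.g x.h x.V x.θ + (∑ q, ∑ i, P.rh i (x.h q i)) + ∑ j, P.rv j (x.V j) : ℝ) : EReal)
    + P.rθ x.θ

end Model

/-! ### The algorithm -/

/-- Blocks `h`: those before `(q, i)` (lexicographically) from `new`, block `(q, i)` equal to `y`,
those after it from `old`. -/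
def mixH (new old : ∀ (_ : Fin n) (i : Fin l), Vec (d i.castSucc.succ)) (q : Fin n) (i : Fin l)
    (y : Vec (d i.castSucc.succ)) : ∀ (_ : Fin n) (i : Fin l), Vec (d i.castSucc.succ) :=
  let m : ∀ (_ : Fin n) (i : Fin l), Vec (d i.castSucc.succ) :=
    fun q' i' => if q' < q ∨ (q' = q ∧ i' < i) then new q' i' else old q' i'
  Function.update m q (Function.update (m q) i y)

/-- Blocks `V`: those before `j` from `new`, block `j` equal to `Y`, those after it from `old`. -/
def mixV (new old : ∀ j : Fin (l + 1), Mat (d j.succ) (d j.castSucc)) (j : Fin (l + 1))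
    (Y : Mat (d j.succ) (d j.castSucc)) : ∀ j : Fin (l + 1), Mat (d j.succ) (d j.castSucc) :=
  Function.update (fun j' => if j' < j then new j' else old j') j Y

/-- Step sizes and extrapolation weights, indexed by the epoch `k`.
`sh k i`, `sv k j` are the step sizes of the `h^{(i)}`- and `V^{(j)}`-updates; they lie between a
positive lower bound and the reciprocal (`μh i`, `μv j`) of the Lipschitz constant of the respective
partial gradient of `g`. The step size of the `θ`-update is `1 / (γ L k)`. -/
structure StepRule (P : Model l n d) where
  γ : ℝ
  one_lt_γ : 1 < γ
  shMin : Fin l → ℝ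
  shMin_pos : ∀ i, 0 < shMin i
  sh : ℕ → Fin l → ℝ
  sh_mem : ∀ k i, sh k i ∈ Set.Icc (shMin i) (P.μh i)
  svMin : Fin (l + 1) → ℝ
  svMin_pos : ∀ j, 0 < svMin j
  sv : ℕ → Fin (l + 1) → ℝ
  sv_mem : ∀ k j, sv k j ∈ Set.Icc (svMin j) (P.μv j)
  μθMin : ℝ
  μθMin_pos : 0 < μθMin
  μθMax : ℝ
  L : ℕ → ℝ
  L_pos : ∀ k, 0 < L k
  μθ_mem : ∀ k, 1 / (γ * L k) ∈ Set.Icc μθMin μθMax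
  δ : ℕ → ℝ
  δmax : ℝ
  δmax_lt_one : δmax < 1
  δ_mem : ∀ k, δ k ∈ Set.Icc 0 δmax
  ω : ℕ → ℝ
  ω_nonneg : ∀ k, 0 ≤ ω k
  ω_le : ∀ k, ω (k + 1) ≤ (γ - 1) / (2 * (γ + 1)) * √(δ (k + 1) * (L k / L (k + 1)))

namespace StepRule

variable {P : Model l n d} (S : StepRule P)

/-- The step size `μ_{θ,k} = 1 / (γ L_{θ,k})`. -/
def μθ (k : ℕ) : ℝ := 1 / (S.γ * S.L k)

/-- The extrapolated point `θ̂_k = θ_k + ω_{k+1} (θ_k - θ_{k-1})`; since `0 - 1 = 0` in `ℕ`, the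
convention `θ_{-1} = θ_0` is built in. -/
def hat (ξ : ℕ → State l n d) (k : ℕ) : ThetaSpace l d :=
  (ξ k).θ + S.ω (k + 1) • ((ξ k).θ - (ξ (k - 1)).θ)

/-- `∇_θ g(h_{k+1}, V_{k+1}, ·)`. -/
def gradθ (P : Model l n d) (ξ : ℕ → State l n d) (k : ℕ) (t : ThetaSpace l d) :
    ThetaSpace l d :=
  gradient (fun u => P.g (ξ (k + 1)).h (ξ (k + 1)).V u) t

/-- `ξ k = (h_k, V_k, θ_k)` is generated by the extrapolated alternating proximal gradient method:
epoch `k + 1` updates the blocks `h_q^{(i)}` in lexicographic order of `(q, i)`, then the `V^{(j)}`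
in order, then `θ`. The number `L (k + 1)` is a Lipschitz constant of `∇_θ g(h_{k+1}, V_{k+1}, ·)`
on the box `‖θ‖_∞ ≤ M` together with the extrapolated point. -/
structure IsGenerated (ξ : ℕ → State l n d) : Prop where
  h_step : ∀ k q i, IsProx (fun y => (P.rh i y : EReal)) (S.sh (k + 1) i)
    ((ξ k).h q i - S.sh (k + 1) i •
      gradient (fun y => P.g (mixH (ξ (k + 1)).h (ξ k).h q i y) (ξ k).V (ξ k).θ) ((ξ k).h q i))
    ((ξ (k + 1)).h q i)
  V_step : ∀ k j, IsProx (fun Y => (P.rv j Y : EReal)) (S.sv (k + 1) j)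
    ((ξ k).V j - S.sv (k + 1) j •
      gradient (fun Y => P.g (ξ (k + 1)).h (mixV (ξ (k + 1)).V (ξ k).V j Y) (ξ k).θ) ((ξ k).V j))
    ((ξ (k + 1)).V j)
  lipschitz : ∀ k, ∀ t ∈ insert (S.hat ξ k) P.box, ∀ u ∈ insert (S.hat ξ k) P.box,
    ‖gradθ P ξ k t - gradθ P ξ k u‖ ≤ S.L (k + 1) * ‖t - u‖
  θ_step : ∀ k, IsProx P.rθ (S.μθ (k + 1))
    (S.hat ξ k - S.μθ (k + 1) • gradθ P ξ k (S.hat ξ k)) ((ξ (k + 1)).θ)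

end StepRule

end Model

end DNNNSR

end

/-! The argument has two halves: a Lyapunov function forces successive iterates together, and the
optimality conditions of the proximal steps then pass to the limit.

Given `θ`, the smooth part is a separable quadratic in the blocks of `h` and `V`, with curvatures
`1/μh i` and `1/μv j`. A convex proximal gradient step of size at most the inverse curvature
therefore decreases the objective by a multiple of the squared increment
(`quadratic_prox_step_decrease`). The `θ`-step is a projected gradient step from an extrapolated
point; it gains `(γ-1)/4 · L_{k+1} ‖θ_{k+1} - θ_k‖²` and loses a multiple of the squared
extrapolation length (`extrapolated_projected_step_decrease`). The bound on `ω` makes that loss at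
most `δmax` times the previous gain (`norm_sq_hat_sub_le`). Since `δmax < 1`, the objective plus the
last gain decreases; it is nonnegative, so all increments tend to zero (`tendsto_decrement`).

Along a convergent subsequence the next iterates and the extrapolated points consequently have the
same limit. The step sizes are bounded below, so the variational inequalities of the proximal steps
yield first-order conditions block by block at the limit. The nonsmooth part is separable and
convex, so these add up to `0` being a Fréchet subgradient (`isCriticalPt_of_blockwise`). Convexity
and continuity of the nuclear norm come from its duality with the operator norm. -/

noncomputable section

namespace DNNNSR

/-! ### Convexity of the nuclear norm -/

section NuclearNorm

variable {E F : Type*} [NormedAddCommGroup E] [InnerProductSpace ℝ E] [FiniteDimensional ℝ E]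
  [NormedAddCommGroup F] [InnerProductSpace ℝ F] [FiniteDimensional ℝ F]

/-- The eigenbasis of `Tᵀ T` is a basis of right singular vectors. -/
theorem inner_apply_eigenvectorBasis (T : E →ₗ[ℝ] F) {N : ℕ} (hN : Module.finrank ℝ E = N)
    (i j : Fin N) :
    inner ℝ (T (T.isSymmetric_adjoint_comp_self.eigenvectorBasis hN i))
      (T (T.isSymmetric_adjoint_comp_self.eigenvectorBasis hN j)) =
      if i = j then T.singularValues i ^ 2 else 0 := by
  set v := T.isSymmetric_adjoint_comp_self.eigenvectorBasis hN
  have h := T.isSymmetric_adjoint_comp_self.apply_eigenvectorBasis hN i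
  rw [← LinearMap.adjoint_inner_left, ← LinearMap.comp_apply, h, inner_smul_left,
    T.sq_singularValues_fin hN]
  have := orthonormal_iff_ite.1 v.orthonormal i j
  rw [this]
  split_ifs <;> simp

theorem norm_apply_eigenvectorBasis (T : E →ₗ[ℝ] F) {N : ℕ} (hN : Module.finrank ℝ E = N)
    (i : Fin N) :
    ‖T (T.isSymmetric_adjoint_comp_self.eigenvectorBasis hN i)‖ = T.singularValues i := by
  have h := inner_apply_eigenvectorBasis T hN i i
  rw [real_inner_self_eq_norm_sq, if_pos rfl] at h
  exact (sq_eq_sq₀ (norm_nonneg _) (T.singularValues_nonneg i)).1 h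

/-- The trace pairing with a contraction is bounded by the sum of the singular values. -/
theorem trace_comp_le_sum_singularValues (T : E →ₗ[ℝ] F) (C : F →ₗ[ℝ] E)
    (hC : ∀ y, ‖C y‖ ≤ ‖y‖) :
    LinearMap.trace ℝ E (C ∘ₗ T) ≤
      ∑ i ∈ Finset.range (Module.finrank ℝ E), T.singularValues i := by
  rw [LinearMap.trace_eq_sum_inner _ (T.isSymmetric_adjoint_comp_self.eigenvectorBasis rfl),
    Finset.sum_range]
  refine Finset.sum_le_sum fun i _ => (real_inner_le_norm _ _).trans ?_
  rw [OrthonormalBasis.norm_eq_one, one_mul, LinearMap.comp_apply]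
  exact (hC _).trans_eq (norm_apply_eigenvectorBasis T rfl i)

/-- The sum of the singular values is attained as the trace pairing with a contraction. -/
theorem exists_trace_comp_eq_sum_singularValues (T : E →ₗ[ℝ] F) :
    ∃ C : F →ₗ[ℝ] E, (∀ y, ‖C y‖ ≤ ‖y‖) ∧ LinearMap.trace ℝ E (C ∘ₗ T) =
      ∑ i ∈ Finset.range (Module.finrank ℝ E), T.singularValues i := by
  set v := T.isSymmetric_adjoint_comp_self.eigenvectorBasis rfl with hv
  -- Left singular vectors. Since `0⁻¹ = 0`, `u i` vanishes when the singular value does, so no case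
  -- distinction is needed below.
  set u : Fin (Module.finrank ℝ E) → F := fun i => (T.singularValues i)⁻¹ • T (v i) with hu
  have huu : ∀ i j, inner ℝ (u i) (T (v j)) = if i = j then T.singularValues i else 0 := by
    intro i j
    rw [hu, inner_smul_left, hv, inner_apply_eigenvectorBasis]
    by_cases hij : i = j
    · rw [if_pos hij, if_pos hij, RCLike.conj_to_real]
      by_cases h0 : T.singularValues i = 0
      · simp [h0]
      · field_simp
    · simp [hij]
  have hon : Orthonormal ℝ (fun i : {i // T.singularValues (Fin.val i) ≠ 0} => u i.1) := by
    rw [orthonormal_iff_ite]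
    rintro ⟨i, hi⟩ ⟨j, hj⟩
    have h : u j = (T.singularValues j)⁻¹ • T (v j) := rfl
    dsimp only
    rw [h, inner_smul_right, huu]
    by_cases hij : i = j
    · subst hij; simp [hi]
    · simp [hij]
  -- Bessel's inequality for the nonzero `u i`; the remaining ones contribute nothing.
  have hC : ∀ y, ‖∑ i, inner ℝ (u i) y • v i‖ ^ 2 ≤ ‖y‖ ^ 2 := by
    intro y
    have h1 : ‖∑ i, inner ℝ (u i) y • v i‖ ^ 2 = ∑ i, (inner ℝ (u i) y) ^ 2 := by
      rw [← real_inner_self_eq_norm_sq, v.orthonormal.inner_sum]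
      simp [sq]
    have h2 := hon.sum_inner_products_le y (s := Finset.univ)
    rw [h1]
    refine le_trans (le_of_eq ?_) h2
    rw [← Finset.sum_subtype (Finset.univ.filter fun i => T.singularValues (Fin.val i) ≠ 0)
      (by simp) (fun i => ‖inner ℝ (u i) y‖ ^ 2), Finset.sum_filter]
    refine Finset.sum_congr rfl fun i _ => ?_
    split_ifs with h
    · simp
    · have : u i = 0 := by rw [hu]; simp [not_not.1 h]
      simp [this]
  refine ⟨∑ i, ((innerₛₗ ℝ (u i)).smulRight (v i)), fun y => ?_, ?_⟩
  · have : (∑ i, ((innerₛₗ ℝ (u i)).smulRight (v i))) y = ∑ i, inner ℝ (u i) y • v i := by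
      simp [LinearMap.sum_apply]
    rw [this]
    exact le_of_sq_le_sq (hC y) (norm_nonneg _)
  · rw [LinearMap.trace_eq_sum_inner _ v, Finset.sum_range]
    refine Finset.sum_congr rfl fun j _ => ?_
    simp only [LinearMap.comp_apply, LinearMap.sum_apply, LinearMap.smulRight_apply,
      innerₛₗ_apply_apply, huu, ite_smul, zero_smul, Finset.sum_ite_eq', Finset.mem_univ, if_true,
      inner_smul_right]
    simp

/-- By the two preceding results this is a maximum of linear functionals `T ↦ tr (C T)` over
contractions `C`. A maximizer for the combination is tested on each summand. -/
theorem convexOn_sum_singularValues :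
    ConvexOn ℝ Set.univ fun T : E →ₗ[ℝ] F =>
      ∑ i ∈ Finset.range (Module.finrank ℝ E), T.singularValues i := by
  refine ⟨convex_univ, fun A _ B _ a b ha hb _ => ?_⟩
  obtain ⟨C, hC, h⟩ := exists_trace_comp_eq_sum_singularValues (a • A + b • B)
  dsimp only
  rw [← h, LinearMap.comp_add, LinearMap.comp_smul, LinearMap.comp_smul, map_add, map_smul,
    map_smul]
  exact add_le_add (mul_le_mul_of_nonneg_left (trace_comp_le_sum_singularValues A C hC) ha)
    (mul_le_mul_of_nonneg_left (trace_comp_le_sum_singularValues B C hC) hb)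

theorem convexOn_nuclearNorm {a b : ℕ} : ConvexOn ℝ Set.univ (nuclearNorm (a := a) (b := b)) := by
  let Φ : Mat a b →ₗ[ℝ] (EuclideanSpace ℝ (Fin b) →ₗ[ℝ] EuclideanSpace ℝ (Fin a)) :=
    { toFun := fun A => Matrix.toEuclideanLin (Matrix.of fun r c => A (r, c))
      map_add' := fun A B => by rw [← map_add]; rfl
      map_smul' := fun t A => by rw [RingHom.id_apply, ← map_smul]; rfl }
  have h := (convexOn_sum_singularValues (E := EuclideanSpace ℝ (Fin b))
    (F := EuclideanSpace ℝ (Fin a))).comp_linearMap Φ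
  rw [Set.preimage_univ, finrank_euclideanSpace_fin] at h
  exact h

theorem nuclearNorm_nonneg {a b : ℕ} (A : Mat a b) : 0 ≤ nuclearNorm A :=
  Finset.sum_nonneg fun i _ => LinearMap.singularValues_nonneg _ i

theorem continuous_nuclearNorm {a b : ℕ} : Continuous (nuclearNorm (a := a) (b := b)) :=
  convexOn_nuclearNorm.locallyLipschitz.continuous

end NuclearNorm

/-! ### Proximal steps, descent lemma -/

section Variational

variable {E : Type*} [NormedAddCommGroup E] [InnerProductSpace ℝ E]

/-- First-order optimality condition of a proximal step with a convex function on a convex set. -/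
theorem prox_variational_inequality {s : Set E} {r : E → ℝ} (hr : ConvexOn ℝ s r) {σ : ℝ}
    (hσ : 0 < σ) {x y : E} (hy : y ∈ s)
    (hmin : ∀ u ∈ s, r y + ‖y - x‖ ^ 2 / (2 * σ) ≤ r u + ‖u - x‖ ^ 2 / (2 * σ))
    {u : E} (hu : u ∈ s) : r y + inner ℝ (x - y) (u - y) / σ ≤ r u := by
  -- Minimality is tested at a point of the segment from `y` to `u`; after division by `t`, the
  -- quadratic remainder is of order `t`.
  have key : ∀ t ∈ Set.Ioo (0 : ℝ) 1,
      r y + inner ℝ (x - y) (u - y) / σ ≤ r u + t * (‖u - y‖ ^ 2 / (2 * σ)) := by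
    rintro t ⟨ht0, ht1⟩
    have hmem : (1 - t) • y + t • u ∈ s := hr.1 hy hu (by linarith) ht0.le (by ring)
    have h1 := hmin _ hmem
    have h2 := hr.2 hy hu (by linarith : (0 : ℝ) ≤ 1 - t) ht0.le (by ring)
    have h3 : (1 - t) • y + t • u - x = (y - x) + t • (u - y) := by module
    rw [h3, norm_add_sq_real, inner_smul_right, norm_smul, mul_pow, Real.norm_eq_abs, sq_abs] at h1
    have h4 : inner ℝ (x - y) (u - y) = - inner ℝ (y - x) (u - y) := by
      rw [← inner_neg_left, neg_sub]
    rw [h4]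
    simp only [smul_eq_mul] at h2
    have h5 : (‖y - x‖ ^ 2 + 2 * (t * inner ℝ (y - x) (u - y)) + t ^ 2 * ‖u - y‖ ^ 2) / (2 * σ)
      = ‖y - x‖ ^ 2 / (2 * σ) + t * (inner ℝ (y - x) (u - y) / σ
        + t * (‖u - y‖ ^ 2 / (2 * σ))) := by
      field_simp
      ring
    rw [h5] at h1
    have h6 : t * (r y) ≤ t * (r u + (inner ℝ (y - x) (u - y) / σ
        + t * (‖u - y‖ ^ 2 / (2 * σ)))) := by linarith
    have h7 := le_of_mul_le_mul_left h6 ht0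
    rw [neg_div]
    linarith
  have hlim : Tendsto (fun t : ℝ => r u + t * (‖u - y‖ ^ 2 / (2 * σ))) (𝓝[>] 0) (𝓝 (r u)) := by
    have : Tendsto (fun t : ℝ => r u + t * (‖u - y‖ ^ 2 / (2 * σ))) (𝓝 0)
        (𝓝 (r u + 0 * (‖u - y‖ ^ 2 / (2 * σ)))) := by
      apply Continuous.tendsto
      fun_prop
    simpa using this.mono_left nhdsWithin_le_nhds
  refine ge_of_tendsto hlim ?_
  filter_upwards [Ioo_mem_nhdsGT (zero_lt_one' ℝ)] with t ht using key t ht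

/-- Optimality condition of a proximal step with a real-valued convex function. -/
theorem IsProx.variational_inequality {r : E → ℝ} (hr : ConvexOn ℝ Set.univ r) {σ : ℝ}
    (hσ : 0 < σ) {x y : E} (h : IsProx (fun y => (r y : EReal)) σ x y) (u : E) :
    r y + inner ℝ (x - y) (u - y) / σ ≤ r u :=
  prox_variational_inequality hr hσ (Set.mem_univ y) (fun u _ => EReal.coe_le_coe_iff.1 (h u))
    (Set.mem_univ u)

/-- Sufficient decrease of a proximal gradient step for `r + ‖z - ·‖² / (2 μ)` with a step size at
most `μ`. -/
theorem quadratic_prox_step_decrease {r : E → ℝ} {σ μ : ℝ} (hσ : 0 < σ) (hσμ : σ ≤ μ) {z x y : E}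
    (h : r y + inner ℝ (x - σ • (μ⁻¹ • (x - z)) - y) (x - y) / σ ≤ r x) :
    1 / (2 * μ) * ‖z - y‖ ^ 2 + r y + 1 / (2 * μ) * ‖y - x‖ ^ 2
      ≤ 1 / (2 * μ) * ‖z - x‖ ^ 2 + r x := by
  have hμ : 0 < μ := hσ.trans_le hσμ
  have e1 : inner ℝ (x - σ • (μ⁻¹ • (x - z)) - y) (x - y) / σ
      = ‖x - y‖ ^ 2 / σ + μ⁻¹ * inner ℝ (z - x) (x - y) := by
    have : x - σ • (μ⁻¹ • (x - z)) - y = (x - y) + (σ * μ⁻¹) • (z - x) := by module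
    rw [this, inner_add_left, inner_smul_left, real_inner_self_eq_norm_sq, RCLike.conj_to_real]
    field_simp
  have e2 : ‖z - y‖ ^ 2 = ‖z - x‖ ^ 2 + 2 * inner ℝ (z - x) (x - y) + ‖x - y‖ ^ 2 := by
    rw [← norm_add_sq_real]
    congr 2
    abel
  rw [e1] at h
  rw [e2, norm_sub_rev y x]
  -- Half of `‖x - y‖² / μ` pays for the quadratic expansion `e2`; the other half is the decrease.
  have h3 : ‖x - y‖ ^ 2 / μ ≤ ‖x - y‖ ^ 2 / σ := by gcongr
  have e4 : 1 / (2 * μ) * (‖z - x‖ ^ 2 + 2 * inner ℝ (z - x) (x - y) + ‖x - y‖ ^ 2) + r y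
      + 1 / (2 * μ) * ‖x - y‖ ^ 2 = 1 / (2 * μ) * ‖z - x‖ ^ 2 + r y + ‖x - y‖ ^ 2 / μ
        + μ⁻¹ * inner ℝ (z - x) (x - y) := by
    field_simp
    ring
  rw [e4]
  linarith

/-- The constant `c` stands for the part of the objective that does not involve the block being
updated. -/
theorem hasGradientAt_const_add_quadratic [CompleteSpace E] (c μ : ℝ) (z y : E) :
    HasGradientAt (fun y => c + 1 / (2 * μ) * ‖z - y‖ ^ 2) (μ⁻¹ • (y - z)) y := by
  rw [hasGradientAt_iff_hasFDerivAt]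
  have h := ((((hasFDerivAt_id y).const_sub z).norm_sq).const_mul (1 / (2 * μ))).const_add c
  refine h.congr_fderiv ?_
  ext v
  simp
  ring

/-- Descent lemma on a convex set. -/
theorem descent_of_lipschitz_gradient [CompleteSpace E] {s : Set E} (hs : Convex ℝ s) {f : E → ℝ}
    (hf : Differentiable ℝ f) {L : ℝ}
    (hL : ∀ x ∈ s, ∀ y ∈ s, ‖gradient f x - gradient f y‖ ≤ L * ‖x - y‖) {x y : E} (hx : x ∈ s)
    (hy : y ∈ s) :
    f y ≤ f x + inner ℝ (gradient f x) (y - x) + L / 2 * ‖y - x‖ ^ 2 := by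
  -- The defect of the claimed bound along the segment; the Lipschitz estimate makes its derivative
  -- nonpositive.
  set φ : ℝ → ℝ := fun t => f (x + t • (y - x)) - t * inner ℝ (gradient f x) (y - x)
    - t ^ 2 * (L / 2 * ‖y - x‖ ^ 2) with hφ
  have hd : ∀ t, HasDerivAt φ (inner ℝ (gradient f (x + t • (y - x))) (y - x)
      - inner ℝ (gradient f x) (y - x) - 2 * t * (L / 2 * ‖y - x‖ ^ 2)) t := by
    intro t
    have h1 : HasDerivAt (fun t : ℝ => x + t • (y - x)) (y - x) t := by
      simpa using ((hasDerivAt_id t).smul_const (y - x)).const_add x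
    have h2 := ((hf (x + t • (y - x))).hasGradientAt.hasFDerivAt).comp_hasDerivAt t h1
    have h3 := (hasDerivAt_id t).mul_const (inner ℝ (gradient f x) (y - x))
    have h4 := (hasDerivAt_pow 2 t).mul_const (L / 2 * ‖y - x‖ ^ 2)
    refine ((h2.sub h3).sub h4).congr_deriv ?_
    simp
  have hanti : AntitoneOn φ (Set.Icc 0 1) := by
    refine antitoneOn_of_deriv_nonpos (convex_Icc 0 1)
      (fun t _ => (hd t).continuousAt.continuousWithinAt)
      (fun t _ => (hd t).differentiableAt.differentiableWithinAt) fun t ht => ?_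
    rw [interior_Icc] at ht
    rw [(hd t).deriv, ← inner_sub_left]
    have hmem : x + t • (y - x) ∈ s := by
      have := hs hx hy (by linarith [ht.2] : (0 : ℝ) ≤ 1 - t) ht.1.le (by ring)
      convert this using 1
      module
    have h1 := hL _ hmem _ hx
    rw [add_sub_cancel_left, norm_smul, Real.norm_of_nonneg ht.1.le] at h1
    have h2 := real_inner_le_norm (gradient f (x + t • (y - x)) - gradient f x) (y - x)
    have h3 := mul_le_mul_of_nonneg_right h1 (norm_nonneg (y - x))
    nlinarith
  have h := hanti (Set.left_mem_Icc.2 zero_le_one) (Set.right_mem_Icc.2 zero_le_one) zero_le_one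
  simp only [hφ, zero_smul, one_smul, add_zero, add_sub_cancel] at h
  linarith

/-- Decrease, up to the extrapolation error, of a projected gradient step that starts from an
extrapolated point `t`, for a function with Lipschitz gradient. -/
theorem extrapolated_projected_step_decrease [CompleteSpace E] {s : Set E} (hs : Convex ℝ s)
    {f : E → ℝ} (hf : Differentiable ℝ f) {L γ : ℝ} (hL0 : 0 < L) (hγ : 1 < γ) {t : E}
    (hL : ∀ x ∈ insert t s, ∀ y ∈ insert t s, ‖gradient f x - gradient f y‖ ≤ L * ‖x - y‖)
    {x y : E} (hx : x ∈ s) (hy : y ∈ s)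
    (h : inner ℝ (t - (1 / (γ * L)) • gradient f t - y) (x - y) ≤ 0) :
    f y + (γ - 1) / 4 * L * ‖y - x‖ ^ 2
      ≤ f x + (γ + 1) ^ 2 / (γ - 1) * (L * ‖t - x‖ ^ 2) := by
  have hγL : 0 < γ * L := by positivity
  -- The descent lemma is applied inside `s` only. The extrapolated point may lie outside and enters
  -- solely through the comparison of gradients at `x` and `t`.
  have h1 := descent_of_lipschitz_gradient hs hf
    (fun x hx y hy => hL x (Set.mem_insert_of_mem t hx) y (Set.mem_insert_of_mem t hy)) hx hy
  have h2 := hL x (Set.mem_insert_of_mem t hx) t (Set.mem_insert t s)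
  rw [norm_sub_rev x t] at h2
  have h3 := (real_inner_le_norm (gradient f x - gradient f t) (y - x)).trans
    (mul_le_mul_of_nonneg_right h2 (norm_nonneg _))
  have h4 := real_inner_le_norm (t - x) (y - x)
  have e1 : t - (1 / (γ * L)) • gradient f t - y
      = (t - x) - (y - x) - (1 / (γ * L)) • gradient f t := by module
  rw [e1, ← neg_sub y x, inner_neg_right, inner_sub_left, inner_sub_left, inner_smul_left,
    real_inner_self_eq_norm_sq, RCLike.conj_to_real] at h
  rw [inner_sub_left] at h3
  set D := ‖y - x‖
  set e := ‖t - x‖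
  have h5 : inner ℝ (gradient f t) (y - x) ≤ γ * L * (inner ℝ (t - x) (y - x) - D ^ 2) := by
    have := mul_le_mul_of_nonneg_left h hγL.le
    have e2 : γ * L * (1 / (γ * L) * inner ℝ (gradient f t) (y - x))
      = inner ℝ (gradient f t) (y - x) := by field_simp
    linarith
  have h6 : γ * L * inner ℝ (t - x) (y - x) ≤ γ * L * (e * D) :=
    mul_le_mul_of_nonneg_left h4 hγL.le
  -- Young's inequality: the cross terms total `(γ + 1) L e D`, and `(γ - 1) / 4` of the available
  -- coefficient `γ - 1/2` of `L D²` is spent on them.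
  have h7 : (γ + 1) * (e * D) ≤ (γ - 1) / 4 * D ^ 2 + (γ + 1) ^ 2 / (γ - 1) * e ^ 2 := by
    have hg : 0 < γ - 1 := by linarith
    have e3 : (γ - 1) / 4 * D ^ 2 + (γ + 1) ^ 2 / (γ - 1) * e ^ 2 - (γ + 1) * (e * D)
      = ((γ - 1) / 2 * D - (γ + 1) * e) ^ 2 / (γ - 1) := by
      field_simp
      ring
    have : 0 ≤ ((γ - 1) / 2 * D - (γ + 1) * e) ^ 2 / (γ - 1) := by positivity
    linarith
  have h8 := mul_le_mul_of_nonneg_left h7 hL0.le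
  have h9 : 0 ≤ γ * L * D ^ 2 := by positivity
  have h10 : 0 ≤ L * D ^ 2 := by positivity
  nlinarith

end Variational

/-! ### Smoothness of the model -/

section WithLpSmooth

variable {X E F : Type*} [NormedAddCommGroup X] [NormedSpace ℝ X] [NormedAddCommGroup E]
  [NormedSpace ℝ E] [NormedAddCommGroup F] [NormedSpace ℝ F]

@[fun_prop]
theorem contDiff_withLp_fst {m : WithTop ℕ∞} {f : X → WithLp 2 (E × F)} (hf : ContDiff ℝ m f) :
    ContDiff ℝ m fun x => (f x).fst :=
  (WithLp.fstL 2 ℝ E F).contDiff.comp hf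

@[fun_prop]
theorem contDiff_withLp_snd {m : WithTop ℕ∞} {f : X → WithLp 2 (E × F)} (hf : ContDiff ℝ m f) :
    ContDiff ℝ m fun x => (f x).snd :=
  (WithLp.sndL 2 ℝ E F).contDiff.comp hf

end WithLpSmooth

theorem toLp_prodMk_add {E F : Type*} [AddCommGroup E] [AddCommGroup F]
    (a a' : E) (b b' : F) :
    (WithLp.toLp 2 (a, b) + WithLp.toLp 2 (a', b') : WithLp 2 (E × F))
      = WithLp.toLp 2 (a + a', b + b') := rfl

section Model

variable {l n : ℕ} {d : Fin (l + 2) → ℕ}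

/-- The state `(h, V, t)` whose blocks `h`, `V` are those of `x`. -/
def State.withTheta (x : State l n d) (t : ThetaSpace l d) : State l n d :=
  WithLp.toLp 2 (x.fst, WithLp.toLp 2 (x.snd.fst, t))

/-- The inclusion `t ↦ (0, 0, t)`. -/
def thetaInclusion (l n : ℕ) (d : Fin (l + 2) → ℕ) : ThetaSpace l d →L[ℝ] State l n d :=
  (WithLp.prodContinuousLinearEquiv 2 ℝ _ _).symm.toContinuousLinearMap ∘L
    ContinuousLinearMap.inr ℝ _ _ ∘L
    (WithLp.prodContinuousLinearEquiv 2 ℝ _ _).symm.toContinuousLinearMap ∘L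
    ContinuousLinearMap.inr ℝ _ _

theorem thetaInclusion_apply (t : ThetaSpace l d) :
    thetaInclusion l n d t = WithLp.toLp 2 (0, WithLp.toLp 2 (0, t)) := rfl

theorem hasFDerivAt_withTheta (x : State l n d) (t : ThetaSpace l d) :
    HasFDerivAt x.withTheta (thetaInclusion l n d) t := by
  have h : x.withTheta = fun t => x.withTheta 0 + thetaInclusion l n d t := by
    funext t
    rw [thetaInclusion_apply, State.withTheta, State.withTheta, toLp_prodMk_add, toLp_prodMk_add,
      add_zero, add_zero, zero_add]
  rw [h]
  exact (thetaInclusion l n d).hasFDerivAt.const_add _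

theorem continuous_withTheta :
    Continuous fun p : State l n d × ThetaSpace l d => p.1.withTheta p.2 := by
  unfold State.withTheta
  fun_prop

@[fun_prop]
theorem continuous_h (q : Fin n) (i : Fin l) : Continuous fun x : State l n d => x.h q i := by
  unfold State.h
  fun_prop

@[fun_prop]
theorem continuous_V (j : Fin (l + 1)) : Continuous fun x : State l n d => x.V j := by
  unfold State.V
  fun_prop

@[fun_prop]
theorem continuous_θ : Continuous fun x : State l n d => x.θ := by
  unfold State.θ
  fun_prop

/-! ### Partially updated blocks -/

theorem mixH_apply_self (new old : ∀ (_ : Fin n) (i : Fin l), Vec (d i.castSucc.succ)) (q : Fin n)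
    (i : Fin l) (y : Vec (d i.castSucc.succ)) : mixH new old q i y q i = y := by
  simp [mixH]

theorem mixH_apply_of_ne (new old : ∀ (_ : Fin n) (i : Fin l), Vec (d i.castSucc.succ))
    {q q' : Fin n} {i i' : Fin l} (h : q' ≠ q ∨ i' ≠ i) (y y' : Vec (d i.castSucc.succ)) :
    mixH new old q i y q' i' = mixH new old q i y' q' i' := by
  by_cases hq : q' = q
  · subst hq
    simp [mixH, h.resolve_left (by simp)]
  · simp [mixH, hq]

theorem mixV_apply_self (new old : ∀ j : Fin (l + 1), Mat (d j.succ) (d j.castSucc))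
    (j : Fin (l + 1)) (Y : Mat (d j.succ) (d j.castSucc)) : mixV new old j Y j = Y := by
  simp [mixV]

theorem mixV_apply_of_ne (new old : ∀ j : Fin (l + 1), Mat (d j.succ) (d j.castSucc))
    {j j' : Fin (l + 1)} (h : j' ≠ j) (Y Y' : Mat (d j.succ) (d j.castSucc)) :
    mixV new old j Y j' = mixV new old j Y' j' := by
  simp [mixV, h]

namespace Model

variable (P : Model l n d)

theorem layer_succ (θ : ThetaSpace l d) (x : Vec (d 0)) (j : Fin (l + 1)) :
    P.layer θ x j.succ = P.act j (WithLp.toLp 2 fun r =>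
      (∑ c, θ.fst j (r, c) * P.layer θ x j.castSucc c) + θ.snd j r) :=
  rfl

theorem contDiff_layer (x : Vec (d 0)) (i : Fin (l + 2)) :
    ContDiff ℝ 2 fun θ : ThetaSpace l d => P.layer θ x i := by
  induction i using Fin.induction with
  | zero => exact contDiff_const
  | succ j ih =>
    simp only [layer_succ]
    refine (P.act_contDiff j).comp (contDiff_euclidean.2 fun r => ?_)
    have hc := contDiff_euclidean.1 ih
    dsimp only
    refine ContDiff.add (ContDiff.sum fun c _ => ContDiff.mul ?_ (hc c)) ?_
    · fun_prop
    · fun_prop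

@[fun_prop]
theorem contDiff_z (q : Fin n) (i : Fin l) :
    ContDiff ℝ 2 fun θ : ThetaSpace l d => P.z θ q i :=
  P.contDiff_layer _ _

theorem contDiff_loss : ContDiff ℝ 2 P.loss := by
  have h : ∀ p : Fin (d 0) × Fin n, ContDiff ℝ 2 fun θ => P.xhat θ p.1 p.2 := fun p =>
    contDiff_euclidean.1 (P.contDiff_layer _ _) _
  unfold loss
  refine ContDiff.add (ContDiff.sum fun p _ => (contDiff_const.sub (h p)).pow 2)
    (contDiff_const.mul (ContDiff.sum fun j _ => ContDiff.norm_sq ℝ ?_))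
  fun_prop

/-- The smooth part of the objective as a function of the state. -/
def smoothPart (x : State l n d) : ℝ := P.g x.h x.V x.θ

theorem contDiff_smoothPart : ContDiff ℝ 2 P.smoothPart := by
  have hθ : ContDiff ℝ 2 fun x : State l n d => x.snd.snd := by fun_prop
  unfold smoothPart g State.h State.V State.θ
  refine ((P.contDiff_loss.comp hθ).add (ContDiff.sum fun q _ => ContDiff.sum fun i _ =>
    contDiff_const.mul (ContDiff.norm_sq ℝ (((P.contDiff_z q i).comp hθ).sub ?_)))).add
    (ContDiff.sum fun j _ => contDiff_const.mul (ContDiff.norm_sq ℝ ?_))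
  · fun_prop
  · fun_prop

/-! ### Partial gradients and the full derivative of the smooth part -/

theorem hasFDerivAt_g_theta (x : State l n d) (t : ThetaSpace l d) :
    HasFDerivAt (fun u => P.g x.h x.V u)
      ((fderiv ℝ P.smoothPart (x.withTheta t)).comp (thetaInclusion l n d)) t := by
  have h : HasFDerivAt P.smoothPart (fderiv ℝ P.smoothPart (x.withTheta t)) (x.withTheta t) :=
    (P.contDiff_smoothPart.differentiable (by norm_num) (x.withTheta t)).hasFDerivAt
  exact HasFDerivAt.comp t h (hasFDerivAt_withTheta x t)

theorem differentiable_g_theta (x : State l n d) :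
    Differentiable ℝ fun u => P.g x.h x.V u :=
  fun t => (P.hasFDerivAt_g_theta x t).differentiableAt

/-- Continuity must be joint, because the algorithm evaluates this gradient at the new `h`, `V` and
the extrapolated `θ`, all of which vary with the epoch. -/
theorem continuous_gradient_g_theta :
    Continuous fun p : State l n d × ThetaSpace l d =>
      gradient (fun u => P.g p.1.h p.1.V u) p.2 := by
  have h : (fun p : State l n d × ThetaSpace l d => gradient (fun u => P.g p.1.h p.1.V u) p.2)
      = fun p => (InnerProductSpace.toDual ℝ _).symm
        ((fderiv ℝ P.smoothPart (p.1.withTheta p.2)).comp (thetaInclusion l n d)) := by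
    funext p
    rw [gradient, (P.hasFDerivAt_g_theta p.1 p.2).fderiv]
  rw [h]
  exact (LinearIsometryEquiv.continuous _).comp
    (((P.contDiff_smoothPart.continuous_fderiv (by norm_num)).comp
      continuous_withTheta).clm_comp continuous_const)

theorem fderiv_smoothPart_apply (x y : State l n d) :
    fderiv ℝ P.smoothPart x (y - x) =
      (∑ q, ∑ i, inner ℝ ((P.μh i)⁻¹ • (x.h q i - P.z x.θ q i)) (y.h q i - x.h q i))
      + (∑ j, inner ℝ ((P.μv j)⁻¹ • (x.V j - x.θ.fst j)) (y.V j - x.V j))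
      + inner ℝ (gradient (fun u => P.g x.h x.V u) x.θ) (y.θ - x.θ) := by
  have hx : x.withTheta x.θ = x := rfl
  -- The `(h, V)`-part of `y - x`. Along `x + t w` the loss and the layer outputs are frozen, so
  -- only quadratics in `t` have to be differentiated.
  set w : State l n d := WithLp.toLp 2 (y.fst - x.fst, WithLp.toLp 2 (y.snd.fst - x.snd.fst, 0))
    with hw
  have hsplit : y - x = w + thetaInclusion l n d (y.θ - x.θ) := by
    rw [thetaInclusion_apply, hw, toLp_prodMk_add, toLp_prodMk_add, add_zero, add_zero,
      zero_add]
    rfl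
  rw [hsplit, map_add]
  congr 1
  · have hline : HasDerivAt (fun t : ℝ => x + t • w) w 0 := by
      simpa using ((hasDerivAt_id (0 : ℝ)).smul_const w).const_add x
    have h1 : HasDerivAt (fun t : ℝ => P.smoothPart (x + t • w)) (fderiv ℝ P.smoothPart x w) 0 := by
      have h : HasFDerivAt P.smoothPart (fderiv ℝ P.smoothPart x) (x + (0 : ℝ) • w) := by
        rw [zero_smul, add_zero]
        exact (P.contDiff_smoothPart.differentiable (by norm_num) x).hasFDerivAt
      exact h.comp_hasDerivAt (0 : ℝ) hline
    have hquad : ∀ {E : Type} [NormedAddCommGroup E] [InnerProductSpace ℝ E] [CompleteSpace E]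
        (μ : ℝ) (z a v : E), HasDerivAt (fun t : ℝ => 1 / (2 * μ) * ‖z - (a + t • v)‖ ^ 2)
          (inner ℝ (μ⁻¹ • (a - z)) v) 0 := by
      intro E _ _ _ μ z a v
      have h := (hasGradientAt_const_add_quadratic 0 μ z a).hasFDerivAt
      simp only [zero_add] at h
      have h : HasFDerivAt (fun y => 1 / (2 * μ) * ‖z - y‖ ^ 2)
          (InnerProductSpace.toDual ℝ E (μ⁻¹ • (a - z))) (a + (0 : ℝ) • v) := by
        rwa [zero_smul, add_zero]
      have hl : HasDerivAt (fun t : ℝ => a + t • v) v 0 := by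
        simpa using ((hasDerivAt_id (0 : ℝ)).smul_const v).const_add a
      exact h.comp_hasDerivAt (0 : ℝ) hl
    have h2 : (fun t : ℝ => P.smoothPart (x + t • w)) = fun t =>
        P.loss x.θ + (∑ q, ∑ i, 1 / (2 * P.μh i) *
          ‖P.z x.θ q i - (x.h q i + t • (y.h q i - x.h q i))‖ ^ 2)
        + ∑ j, 1 / (2 * P.μv j) * ‖x.θ.fst j - (x.V j + t • (y.V j - x.V j))‖ ^ 2 := by
      funext t
      have hθ : (x + t • w).θ = x.θ := by
        change x.θ + t • (0 : ThetaSpace l d) = x.θ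
        simp
      unfold smoothPart g
      rw [hθ]
      rfl
    rw [h2] at h1
    refine h1.unique ?_
    refine HasDerivAt.add (HasDerivAt.const_add _ ?_) ?_
    · exact HasDerivAt.fun_sum fun q _ => HasDerivAt.fun_sum fun i _ => hquad _ _ _ _
    · exact HasDerivAt.fun_sum fun j _ => hquad _ _ _ _
  · rw [gradient, (P.hasFDerivAt_g_theta x x.θ).fderiv, hx,
      InnerProductSpace.toDual_symm_apply]
    rfl

/-- The blocks of `h` are uncoupled once `θ` is fixed, so the order of the sweep leaves no trace in
the gradient. -/
theorem gradient_g_mixH (new old : ∀ (_ : Fin n) (i : Fin l), Vec (d i.castSucc.succ))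
    (V : ∀ j : Fin (l + 1), Mat (d j.succ) (d j.castSucc)) (θ : ThetaSpace l d) (q : Fin n)
    (i : Fin l) (y : Vec (d i.castSucc.succ)) :
    gradient (fun y => P.g (mixH new old q i y) V θ) y = (P.μh i)⁻¹ • (y - P.z θ q i) := by
  have h : (fun y => P.g (mixH new old q i y) V θ) = fun y =>
      (P.g (mixH new old q i 0) V θ - 1 / (2 * P.μh i) * ‖P.z θ q i - 0‖ ^ 2)
        + 1 / (2 * P.μh i) * ‖P.z θ q i - y‖ ^ 2 := by
    funext y
    have hs : (∑ q', ∑ i', 1 / (2 * P.μh i') * ‖P.z θ q' i' - mixH new old q i y q' i'‖ ^ 2)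
        - (∑ q', ∑ i', 1 / (2 * P.μh i') * ‖P.z θ q' i' - mixH new old q i 0 q' i'‖ ^ 2)
        = 1 / (2 * P.μh i) * ‖P.z θ q i - y‖ ^ 2 - 1 / (2 * P.μh i) * ‖P.z θ q i - 0‖ ^ 2 := by
      simp only [← Finset.sum_sub_distrib]
      rw [Finset.sum_eq_single q, Finset.sum_eq_single i, mixH_apply_self, mixH_apply_self]
      · intro i' _ hi
        rw [mixH_apply_of_ne new old (Or.inr hi) y 0, sub_self]
      · simp
      · intro q' _ hq
        refine Finset.sum_eq_zero fun i' _ => ?_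
        rw [mixH_apply_of_ne new old (Or.inl hq) y 0, sub_self]
      · simp
    unfold g
    linarith
  rw [h]
  exact (hasGradientAt_const_add_quadratic _ _ _ _).gradient

theorem gradient_g_mixV (h : ∀ (_ : Fin n) (i : Fin l), Vec (d i.castSucc.succ))
    (new old : ∀ j : Fin (l + 1), Mat (d j.succ) (d j.castSucc)) (θ : ThetaSpace l d)
    (j : Fin (l + 1)) (Y : Mat (d j.succ) (d j.castSucc)) :
    gradient (fun Y => P.g h (mixV new old j Y) θ) Y = (P.μv j)⁻¹ • (Y - θ.fst j) := by
  have h : (fun Y => P.g h (mixV new old j Y) θ) = fun Y =>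
      (P.g h (mixV new old j 0) θ - 1 / (2 * P.μv j) * ‖θ.fst j - 0‖ ^ 2)
        + 1 / (2 * P.μv j) * ‖θ.fst j - Y‖ ^ 2 := by
    funext Y
    have hs : (∑ j', 1 / (2 * P.μv j') * ‖θ.fst j' - mixV new old j Y j'‖ ^ 2)
        - (∑ j', 1 / (2 * P.μv j') * ‖θ.fst j' - mixV new old j 0 j'‖ ^ 2)
        = 1 / (2 * P.μv j) * ‖θ.fst j - Y‖ ^ 2 - 1 / (2 * P.μv j) * ‖θ.fst j - 0‖ ^ 2 := by
      rw [← Finset.sum_sub_distrib, Finset.sum_eq_single j, mixV_apply_self, mixV_apply_self]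
      · intro j' _ hj
        rw [mixV_apply_of_ne new old hj Y 0, sub_self]
      · simp
    unfold g
    linarith
  rw [h]
  exact (hasGradientAt_const_add_quadratic _ _ _ _).gradient

/-! ### The regularizers and the objective -/

theorem convexOn_rh (i : Fin l) : ConvexOn ℝ Set.univ (P.rh i) := by
  refine ⟨convex_univ, fun x _ y _ a b ha hb _ => ?_⟩
  simp only [rh, smul_eq_mul]
  have h : ∑ c, |(a • x + b • y) c| ≤ a * ∑ c, |x c| + b * ∑ c, |y c| := by
    rw [Finset.mul_sum, Finset.mul_sum, ← Finset.sum_add_distrib]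
    refine Finset.sum_le_sum fun c _ => ?_
    have := abs_add_le (a * x c) (b * y c)
    rw [abs_mul, abs_mul, abs_of_nonneg ha, abs_of_nonneg hb] at this
    exact this
  nlinarith [mul_le_mul_of_nonneg_left h (P.α_nonneg i)]

theorem convexOn_rv (j : Fin (l + 1)) : ConvexOn ℝ Set.univ (P.rv j) :=
  convexOn_nuclearNorm.smul (P.β_nonneg j)

@[fun_prop]
theorem continuous_rh (i : Fin l) : Continuous (P.rh i) := by
  unfold rh
  fun_prop

@[fun_prop]
theorem continuous_rv (j : Fin (l + 1)) : Continuous (P.rv j) :=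
  continuous_const.mul continuous_nuclearNorm

theorem rh_nonneg (i : Fin l) (y : Vec (d i.castSucc.succ)) : 0 ≤ P.rh i y :=
  mul_nonneg (P.α_nonneg i) (Finset.sum_nonneg fun _ _ => abs_nonneg _)

theorem rv_nonneg (j : Fin (l + 1)) (Y : Mat (d j.succ) (d j.castSucc)) : 0 ≤ P.rv j Y :=
  mul_nonneg (P.β_nonneg j) (nuclearNorm_nonneg Y)

theorem zero_mem_box : (0 : ThetaSpace l d) ∈ P.box := by
  constructor <;> intros <;> simpa using P.M_pos.le

theorem isClosed_box : IsClosed P.box := by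
  have : P.box = (⋂ j, ⋂ e, {θ : ThetaSpace l d | |θ.fst j e| ≤ P.M}) ∩
      ⋂ j, ⋂ a, {θ : ThetaSpace l d | |θ.snd j a| ≤ P.M} := by
    ext θ
    simp [box]
  rw [this]
  refine (isClosed_iInter fun j => isClosed_iInter fun e => ?_).inter
    (isClosed_iInter fun j => isClosed_iInter fun a => ?_)
  · exact isClosed_le (by fun_prop) continuous_const
  · exact isClosed_le (by fun_prop) continuous_const

theorem convex_box : Convex ℝ P.box := by
  have key : ∀ {a b s t : ℝ}, 0 ≤ a → 0 ≤ b → a + b = 1 → |s| ≤ P.M → |t| ≤ P.M →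
      |a * s + b * t| ≤ P.M := by
    intro a b s t ha hb hab hs ht
    have := abs_add_le (a * s) (b * t)
    rw [abs_mul, abs_mul, abs_of_nonneg ha, abs_of_nonneg hb] at this
    have hM : a * P.M + b * P.M = P.M := by rw [← add_mul, hab, one_mul]
    linarith [mul_le_mul_of_nonneg_left hs ha, mul_le_mul_of_nonneg_left ht hb]
  intro s hs t ht a b ha hb hab
  exact ⟨fun j e => key ha hb hab (hs.1 j e) (ht.1 j e),
    fun j e => key ha hb hab (hs.2 j e) (ht.2 j e)⟩

theorem rθ_of_mem {θ : ThetaSpace l d} (h : θ ∈ P.box) : P.rθ θ = 0 := if_pos h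

theorem rθ_of_notMem {θ : ThetaSpace l d} (h : θ ∉ P.box) : P.rθ θ = ⊤ := if_neg h

/-- The real-valued part `g + ∑ r_h + ∑ r_v` of the objective. -/
def finitePart (x : State l n d) : ℝ :=
  P.g x.h x.V x.θ + (∑ q, ∑ i, P.rh i (x.h q i)) + ∑ j, P.rv j (x.V j)

theorem Q_of_mem {x : State l n d} (h : x.θ ∈ P.box) : P.Q x = P.finitePart x := by
  rw [Q, P.rθ_of_mem h, add_zero, finitePart]

theorem Q_of_notMem {x : State l n d} (h : x.θ ∉ P.box) : P.Q x = ⊤ := by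
  rw [Q, P.rθ_of_notMem h, EReal.coe_add_top]

theorem continuous_finitePart : Continuous P.finitePart := by
  have := P.contDiff_smoothPart.continuous
  unfold smoothPart at this
  unfold finitePart
  fun_prop

theorem g_nonneg (h : ∀ (_ : Fin n) (i : Fin l), Vec (d i.castSucc.succ))
    (V : ∀ j : Fin (l + 1), Mat (d j.succ) (d j.castSucc)) (θ : ThetaSpace l d) :
    0 ≤ P.g h V θ := by
  have hp : ∀ {μ : ℝ}, 0 < μ → ∀ a : ℝ, 0 ≤ 1 / (2 * μ) * a ^ 2 := fun hμ a => by positivity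
  exact add_nonneg (add_nonneg (add_nonneg (Finset.sum_nonneg fun _ _ => sq_nonneg _)
    (mul_nonneg P.lam_pos.le (Finset.sum_nonneg fun _ _ => sq_nonneg _)))
    (Finset.sum_nonneg fun _ _ => Finset.sum_nonneg fun i _ => hp (P.μh_pos i) _))
    (Finset.sum_nonneg fun j _ => hp (P.μv_pos j) _)

theorem finitePart_nonneg (x : State l n d) : 0 ≤ P.finitePart x :=
  add_nonneg (add_nonneg (P.g_nonneg _ _ _)
    (Finset.sum_nonneg fun _ _ => Finset.sum_nonneg fun i _ => P.rh_nonneg i _))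
    (Finset.sum_nonneg fun j _ => P.rv_nonneg j _)

/-- Comparison with `u = 0`, where the proximal objective is finite. -/
theorem IsProx.mem_box {P : Model l n d} {s : ℝ} {x y : ThetaSpace l d} (h : IsProx P.rθ s x y) :
    y ∈ P.box := by
  by_contra hy
  have h0 := h 0
  rw [P.rθ_of_notMem hy, P.rθ_of_mem P.zero_mem_box, EReal.top_add_coe, zero_add, top_le_iff] at h0
  exact EReal.coe_ne_top _ h0

/-- A proximal step of `r_θ` is a projection onto the box. -/
theorem IsProx.inner_box_nonpos {P : Model l n d} {s : ℝ} (hs : 0 < s) {x y : ThetaSpace l d}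
    (h : IsProx P.rθ s x y) {u : ThetaSpace l d} (hu : u ∈ P.box) :
    inner ℝ (x - y) (u - y) ≤ 0 := by
  have hy := IsProx.mem_box h
  have := prox_variational_inequality (r := fun _ => (0 : ℝ)) (convexOn_const 0 P.convex_box) hs
    (x := x) hy (fun u hu => ?_) hu
  · rw [zero_add] at this
    simpa using (div_le_iff₀ hs).1 this
  · have h0 := h u
    rw [P.rθ_of_mem hy, P.rθ_of_mem hu] at h0
    simpa using EReal.coe_le_coe_iff.1 (by simpa using h0)

/-- A point that satisfies the first-order optimality condition in each block is critical. -/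
theorem isCriticalPt_of_blockwise {x : State l n d}
    (hh : ∀ q i u, P.rh i (x.h q i)
      - inner ℝ ((P.μh i)⁻¹ • (x.h q i - P.z x.θ q i)) (u - x.h q i) ≤ P.rh i u)
    (hV : ∀ j U, P.rv j (x.V j)
      - inner ℝ ((P.μv j)⁻¹ • (x.V j - x.θ.fst j)) (U - x.V j) ≤ P.rv j U)
    (hx : x.θ ∈ P.box)
    (hθ : ∀ u ∈ P.box, 0 ≤ inner ℝ (gradient (fun u => P.g x.h x.V u) x.θ) (u - x.θ)) :
    IsCriticalPt P.Q x := by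
  have hQ := P.Q_of_mem hx
  have hT : P.Q x ≠ ⊤ := by rw [hQ]; exact EReal.coe_ne_top _
  have hB : P.Q x ≠ ⊥ := by rw [hQ]; exact EReal.coe_ne_bot _
  -- Constant sequences suffice, since `0` is already a Fréchet subgradient at `x`.
  refine ⟨hT, hB, fun _ => x, fun _ => 0, tendsto_const_nhds, tendsto_const_nhds,
    fun _ => ⟨hT, hB, fun ε hε => ?_⟩, tendsto_const_nhds⟩
  have hd := (P.contDiff_smoothPart.differentiable (by norm_num) x).hasFDerivAt.isLittleO.def hε
  filter_upwards [hd] with y hy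
  by_cases hyb : y.θ ∈ P.box
  · rw [hQ, P.Q_of_mem hyb, ← EReal.coe_add, EReal.coe_le_coe_iff, inner_zero_left, zero_sub]
    rw [P.fderiv_smoothPart_apply, Real.norm_eq_abs] at hy
    have h1 := neg_le_of_abs_le hy
    have h2 : (∑ q, ∑ i, P.rh i (x.h q i)) - (∑ q, ∑ i,
        inner ℝ ((P.μh i)⁻¹ • (x.h q i - P.z x.θ q i)) (y.h q i - x.h q i))
        ≤ ∑ q, ∑ i, P.rh i (y.h q i) := by
      simp only [← Finset.sum_sub_distrib]
      exact Finset.sum_le_sum fun q _ => Finset.sum_le_sum fun i _ => hh q i _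
    have h3 : (∑ j, P.rv j (x.V j)) - (∑ j,
        inner ℝ ((P.μv j)⁻¹ • (x.V j - x.θ.fst j)) (y.V j - x.V j)) ≤ ∑ j, P.rv j (y.V j) := by
      rw [← Finset.sum_sub_distrib]
      exact Finset.sum_le_sum fun j _ => hV j _
    have h4 := hθ _ hyb
    unfold finitePart
    unfold smoothPart at h1
    linarith
  · rw [P.Q_of_notMem hyb]
    exact le_top

end Model

end Model

/-! ### Convergence of the algorithm -/

theorem tendsto_zero_of_norm_sq_le {E : Type*} [NormedAddCommGroup E] {v : ℕ → E} {b : ℕ → ℝ}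
    (C : ℝ) (hb : Tendsto b atTop (𝓝 0)) (h : ∀ k, ‖v k‖ ^ 2 ≤ C * b k) :
    Tendsto v atTop (𝓝 0) := by
  have h1 : Tendsto (fun k => √(C * b k)) atTop (𝓝 0) := by
    have := (hb.const_mul C).sqrt
    rwa [mul_zero, Real.sqrt_zero] at this
  exact squeeze_zero_norm (fun k => Real.le_sqrt_of_sq_le (h k)) h1

section Model

variable {l n : ℕ} {d : Fin (l + 2) → ℕ}

namespace StepRule

variable {P : Model l n d} (S : StepRule P) {ξ : ℕ → State l n d}

theorem γ_pos : 0 < S.γ := zero_lt_one.trans S.one_lt_γ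

theorem μθ_pos (k : ℕ) : 0 < S.μθ k := S.μθMin_pos.trans_le (S.μθ_mem k).1

theorem μθMax_pos : 0 < S.μθMax := (S.μθ_pos 0).trans_le (S.μθ_mem 0).2

/-- The upper bound on the step size keeps `L k` away from zero, so `L`-weighted increments control
plain ones. -/
theorem one_le_mul_L (k : ℕ) : 1 ≤ S.μθMax * S.γ * S.L k := by
  have h := (div_le_iff₀ (mul_pos S.γ_pos (S.L_pos k))).1 (S.μθ_mem k).2
  linarith

theorem sh_pos (k : ℕ) (i : Fin l) : 0 < S.sh k i := (S.shMin_pos i).trans_le (S.sh_mem k i).1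

theorem sv_pos (k : ℕ) (j : Fin (l + 1)) : 0 < S.sv k j :=
  (S.svMin_pos j).trans_le (S.sv_mem k j).1

/-- The extrapolation error is controlled by the previous increment. -/
theorem norm_sq_hat_sub_le (ξ : ℕ → State l n d) (k : ℕ) :
    (S.γ + 1) ^ 2 / (S.γ - 1) * (S.L (k + 1) * ‖S.hat ξ k - (ξ k).θ‖ ^ 2)
      ≤ S.δmax * ((S.γ - 1) / 4 * S.L k * ‖(ξ k).θ - (ξ (k - 1)).θ‖ ^ 2) := by
  have hγ : 0 < S.γ - 1 := by linarith [S.one_lt_γ]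
  have hL := S.L_pos k
  have hL' := S.L_pos (k + 1)
  have hδ := S.δ_mem (k + 1)
  have e1 : S.hat ξ k - (ξ k).θ = S.ω (k + 1) • ((ξ k).θ - (ξ (k - 1)).θ) := by
    rw [hat, add_sub_cancel_left]
  rw [e1, norm_smul, mul_pow, Real.norm_of_nonneg (S.ω_nonneg _)]
  set D := ‖(ξ k).θ - (ξ (k - 1)).θ‖ ^ 2
  have hD : 0 ≤ D := sq_nonneg _
  have hω : S.ω (k + 1) ^ 2 ≤
      ((S.γ - 1) / (2 * (S.γ + 1))) ^ 2 * (S.δ (k + 1) * (S.L k / S.L (k + 1))) := by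
    have h := pow_le_pow_left₀ (S.ω_nonneg (k + 1)) (S.ω_le k) 2
    rwa [mul_pow, Real.sq_sqrt (mul_nonneg hδ.1 (div_pos hL hL').le)] at h
  have hγ1 : 0 < S.γ + 1 := by linarith
  calc (S.γ + 1) ^ 2 / (S.γ - 1) * (S.L (k + 1) * (S.ω (k + 1) ^ 2 * D))
      ≤ (S.γ + 1) ^ 2 / (S.γ - 1) * (S.L (k + 1) *
        (((S.γ - 1) / (2 * (S.γ + 1))) ^ 2 * (S.δ (k + 1) * (S.L k / S.L (k + 1))) * D)) := by
        gcongr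
    -- The factor `(γ - 1) / (2 (γ + 1))` in the bound on `ω` is what turns the Young constant `(γ +
    -- 1)² / (γ - 1)` into `(γ - 1) / 4`.
    _ = S.δ (k + 1) * ((S.γ - 1) / 4 * S.L k * D) := by
        field_simp
        ring
    _ ≤ S.δmax * ((S.γ - 1) / 4 * S.L k * D) := by
        gcongr
        exact hδ.2

namespace IsGenerated

variable {S}

theorem h_variational (hξ : S.IsGenerated ξ) (k : ℕ) (q : Fin n) (i : Fin l)
    (u : Vec (d i.castSucc.succ)) :
    P.rh i ((ξ (k + 1)).h q i)
      + inner ℝ ((ξ k).h q i - S.sh (k + 1) i • ((P.μh i)⁻¹ • ((ξ k).h q i - P.z (ξ k).θ q i))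
        - (ξ (k + 1)).h q i) (u - (ξ (k + 1)).h q i) / S.sh (k + 1) i ≤ P.rh i u := by
  have h := hξ.h_step k q i
  rw [P.gradient_g_mixH] at h
  exact h.variational_inequality (P.convexOn_rh i) (S.sh_pos _ _) u

theorem V_variational (hξ : S.IsGenerated ξ) (k : ℕ) (j : Fin (l + 1))
    (U : Mat (d j.succ) (d j.castSucc)) :
    P.rv j ((ξ (k + 1)).V j)
      + inner ℝ ((ξ k).V j - S.sv (k + 1) j • ((P.μv j)⁻¹ • ((ξ k).V j - (ξ k).θ.fst j))
        - (ξ (k + 1)).V j) (U - (ξ (k + 1)).V j) / S.sv (k + 1) j ≤ P.rv j U := by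
  have h := hξ.V_step k j
  rw [P.gradient_g_mixV] at h
  exact h.variational_inequality (P.convexOn_rv j) (S.sv_pos _ _) U

theorem theta_mem_box (hξ : S.IsGenerated ξ) (k : ℕ) : (ξ (k + 1)).θ ∈ P.box :=
  Model.IsProx.mem_box (hξ.θ_step k)

theorem theta_variational (hξ : S.IsGenerated ξ) (k : ℕ) {u : ThetaSpace l d} (hu : u ∈ P.box) :
    inner ℝ (S.hat ξ k - S.μθ (k + 1) • gradθ P ξ k (S.hat ξ k) - (ξ (k + 1)).θ)
      (u - (ξ (k + 1)).θ) ≤ 0 :=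
  Model.IsProx.inner_box_nonpos (S.μθ_pos _) (hξ.θ_step k) hu

/-- Decrease of the objective in one epoch, up to the extrapolation term. -/
theorem epoch_decrease (hξ : S.IsGenerated ξ) {k : ℕ} (hk : (ξ k).θ ∈ P.box) :
    P.finitePart (ξ (k + 1))
      + (S.γ - 1) / 4 * S.L (k + 1) * ‖(ξ (k + 1)).θ - (ξ k).θ‖ ^ 2
      + (∑ q, ∑ i, 1 / (2 * P.μh i) * ‖(ξ (k + 1)).h q i - (ξ k).h q i‖ ^ 2)
      + (∑ j, 1 / (2 * P.μv j) * ‖(ξ (k + 1)).V j - (ξ k).V j‖ ^ 2)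
      ≤ P.finitePart (ξ k)
        + S.δmax * ((S.γ - 1) / 4 * S.L k * ‖(ξ k).θ - (ξ (k - 1)).θ‖ ^ 2) := by
  have hθ := (extrapolated_projected_step_decrease P.convex_box
    (P.differentiable_g_theta (ξ (k + 1))) (S.L_pos (k + 1)) S.one_lt_γ (hξ.lipschitz k) hk
    (hξ.theta_mem_box k) (hξ.theta_variational k hk)).trans
    (add_le_add_right (S.norm_sq_hat_sub_le ξ k) _)
  have hh : (∑ q, ∑ i, 1 / (2 * P.μh i) * ‖P.z (ξ k).θ q i - (ξ (k + 1)).h q i‖ ^ 2)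
      + (∑ q, ∑ i, P.rh i ((ξ (k + 1)).h q i))
      + (∑ q, ∑ i, 1 / (2 * P.μh i) * ‖(ξ (k + 1)).h q i - (ξ k).h q i‖ ^ 2)
      ≤ (∑ q, ∑ i, 1 / (2 * P.μh i) * ‖P.z (ξ k).θ q i - (ξ k).h q i‖ ^ 2)
        + (∑ q, ∑ i, P.rh i ((ξ k).h q i)) := by
    simp only [← Finset.sum_add_distrib]
    exact Finset.sum_le_sum fun q _ => Finset.sum_le_sum fun i _ =>
      quadratic_prox_step_decrease (S.sh_pos _ _) (S.sh_mem _ _).2 (hξ.h_variational k q i _)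
  have hV : (∑ j, 1 / (2 * P.μv j) * ‖(ξ k).θ.fst j - (ξ (k + 1)).V j‖ ^ 2)
      + (∑ j, P.rv j ((ξ (k + 1)).V j))
      + (∑ j, 1 / (2 * P.μv j) * ‖(ξ (k + 1)).V j - (ξ k).V j‖ ^ 2)
      ≤ (∑ j, 1 / (2 * P.μv j) * ‖(ξ k).θ.fst j - (ξ k).V j‖ ^ 2)
        + (∑ j, P.rv j ((ξ k).V j)) := by
    simp only [← Finset.sum_add_distrib]
    exact Finset.sum_le_sum fun j _ =>
      quadratic_prox_step_decrease (S.sv_pos _ _) (S.sv_mem _ _).2 (hξ.V_variational k j _)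
  have eg : P.g (ξ (k + 1)).h (ξ (k + 1)).V (ξ k).θ = P.loss (ξ k).θ
      + (∑ q, ∑ i, 1 / (2 * P.μh i) * ‖P.z (ξ k).θ q i - (ξ (k + 1)).h q i‖ ^ 2)
      + ∑ j, 1 / (2 * P.μv j) * ‖(ξ k).θ.fst j - (ξ (k + 1)).V j‖ ^ 2 := rfl
  have eg' : P.g (ξ k).h (ξ k).V (ξ k).θ = P.loss (ξ k).θ
      + (∑ q, ∑ i, 1 / (2 * P.μh i) * ‖P.z (ξ k).θ q i - (ξ k).h q i‖ ^ 2)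
      + ∑ j, 1 / (2 * P.μv j) * ‖(ξ k).θ.fst j - (ξ k).V j‖ ^ 2 := rfl
  unfold Model.finitePart
  linarith

/-! ### Lyapunov function and vanishing increments -/

variable (S ξ) in
/-- The guaranteed decrease of the Lyapunov function in epoch `k + 1`. -/
def decrement (k : ℕ) : ℝ :=
  (1 - S.δmax) * ((S.γ - 1) / 4 * S.L k * ‖(ξ k).θ - (ξ (k - 1)).θ‖ ^ 2)
    + (∑ q, ∑ i, 1 / (2 * P.μh i) * ‖(ξ (k + 1)).h q i - (ξ k).h q i‖ ^ 2)
    + ∑ j, 1 / (2 * P.μv j) * ‖(ξ (k + 1)).V j - (ξ k).V j‖ ^ 2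

variable (S ξ) in
/-- The objective plus a multiple of the last squared increment of `θ`. -/
def lyapunov (k : ℕ) : ℝ :=
  P.finitePart (ξ k) + (S.γ - 1) / 4 * S.L k * ‖(ξ k).θ - (ξ (k - 1)).θ‖ ^ 2

theorem theta_term_nonneg (S : StepRule P) (ξ : ℕ → State l n d) (k : ℕ) :
    0 ≤ (S.γ - 1) / 4 * S.L k * ‖(ξ k).θ - (ξ (k - 1)).θ‖ ^ 2 := by
  have hγ : 0 < S.γ - 1 := by linarith [S.one_lt_γ]
  have hL := S.L_pos k
  positivity

theorem h_term_nonneg (P : Model l n d) (ξ : ℕ → State l n d) (k : ℕ) (q : Fin n) (i : Fin l) :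
    0 ≤ 1 / (2 * P.μh i) * ‖(ξ (k + 1)).h q i - (ξ k).h q i‖ ^ 2 := by
  have := P.μh_pos i
  positivity

theorem V_term_nonneg (P : Model l n d) (ξ : ℕ → State l n d) (k : ℕ) (j : Fin (l + 1)) :
    0 ≤ 1 / (2 * P.μv j) * ‖(ξ (k + 1)).V j - (ξ k).V j‖ ^ 2 := by
  have := P.μv_pos j
  positivity

theorem theta_le_decrement (k : ℕ) :
    (1 - S.δmax) * ((S.γ - 1) / 4 * S.L k * ‖(ξ k).θ - (ξ (k - 1)).θ‖ ^ 2)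
      ≤ decrement S ξ k := by
  have h1 := Finset.sum_nonneg fun q (_ : q ∈ Finset.univ) =>
    Finset.sum_nonneg fun i (_ : i ∈ Finset.univ) => h_term_nonneg P ξ k q i
  have h2 := Finset.sum_nonneg fun j (_ : j ∈ Finset.univ) => V_term_nonneg P ξ k j
  unfold decrement
  linarith

theorem h_le_decrement (k : ℕ) (q : Fin n) (i : Fin l) :
    1 / (2 * P.μh i) * ‖(ξ (k + 1)).h q i - (ξ k).h q i‖ ^ 2 ≤ decrement S ξ k := by
  have h0 := mul_nonneg (sub_nonneg.2 S.δmax_lt_one.le) (theta_term_nonneg S ξ k)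
  have h1 := (Finset.single_le_sum (fun i _ => h_term_nonneg P ξ k q i)
    (Finset.mem_univ i)).trans (Finset.single_le_sum (fun q _ => Finset.sum_nonneg fun i _ =>
      h_term_nonneg P ξ k q i) (Finset.mem_univ q))
  have h2 := Finset.sum_nonneg fun j (_ : j ∈ Finset.univ) => V_term_nonneg P ξ k j
  unfold decrement
  linarith

theorem V_le_decrement (k : ℕ) (j : Fin (l + 1)) :
    1 / (2 * P.μv j) * ‖(ξ (k + 1)).V j - (ξ k).V j‖ ^ 2 ≤ decrement S ξ k := by
  have h0 := mul_nonneg (sub_nonneg.2 S.δmax_lt_one.le) (theta_term_nonneg S ξ k)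
  have h1 := Finset.sum_nonneg fun q (_ : q ∈ Finset.univ) =>
    Finset.sum_nonneg fun i (_ : i ∈ Finset.univ) => h_term_nonneg P ξ k q i
  have h2 := Finset.single_le_sum (fun j _ => V_term_nonneg P ξ k j) (Finset.mem_univ j)
  unfold decrement
  linarith

theorem decrement_nonneg (k : ℕ) : 0 ≤ decrement S ξ k :=
  (mul_nonneg (sub_nonneg.2 S.δmax_lt_one.le) (theta_term_nonneg S ξ k)).trans
    (theta_le_decrement k)

theorem tendsto_decrement (hξ : S.IsGenerated ξ) :
    Tendsto (decrement S ξ) atTop (𝓝 0) := by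
  -- The index starts at `1`: the initial `θ` is arbitrary and may lie outside the box, where the
  -- one-epoch estimate is not available.
  have hstep : ∀ k, decrement S ξ (k + 1) ≤ lyapunov S ξ (k + 1) - lyapunov S ξ (k + 1 + 1) := by
    intro k
    have h := hξ.epoch_decrease (hξ.theta_mem_box k)
    unfold decrement lyapunov
    simp only [Nat.add_sub_cancel] at h ⊢
    linarith
  have hanti : Antitone fun k => lyapunov S ξ (k + 1) :=
    antitone_nat_of_succ_le fun k => by
      linarith [hstep k, decrement_nonneg (S := S) (ξ := ξ) (k + 1)]
  have hbelow : BddBelow (Set.range fun k => lyapunov S ξ (k + 1)) :=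
    ⟨0, by
      rintro _ ⟨k, rfl⟩
      exact add_nonneg (P.finitePart_nonneg _) (theta_term_nonneg S ξ _)⟩
  have hlim := tendsto_atTop_ciInf hanti hbelow
  have hdiff := hlim.sub (hlim.comp (tendsto_add_atTop_nat 1))
  rw [sub_self] at hdiff
  exact (tendsto_add_atTop_iff_nat 1).1 (squeeze_zero (fun k => decrement_nonneg _) hstep hdiff)

theorem tendsto_h_diff (hξ : S.IsGenerated ξ) (q : Fin n) (i : Fin l) :
    Tendsto (fun k => (ξ k).h q i - (ξ (k + 1)).h q i) atTop (𝓝 0) := by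
  refine tendsto_zero_of_norm_sq_le (2 * P.μh i) hξ.tendsto_decrement fun k => ?_
  have hμ : 0 < 2 * P.μh i := mul_pos two_pos (P.μh_pos i)
  have h := h_le_decrement (S := S) (ξ := ξ) k q i
  rwa [one_div, inv_mul_le_iff₀ hμ, norm_sub_rev] at h

theorem tendsto_V_diff (hξ : S.IsGenerated ξ) (j : Fin (l + 1)) :
    Tendsto (fun k => (ξ k).V j - (ξ (k + 1)).V j) atTop (𝓝 0) := by
  refine tendsto_zero_of_norm_sq_le (2 * P.μv j) hξ.tendsto_decrement fun k => ?_
  have hμ : 0 < 2 * P.μv j := mul_pos two_pos (P.μv_pos j)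
  have h := V_le_decrement (S := S) (ξ := ξ) k j
  rwa [one_div, inv_mul_le_iff₀ hμ, norm_sub_rev] at h

theorem L_mul_norm_sq_theta_le (k : ℕ) :
    (S.γ - 1) / 4 * S.L k * ‖(ξ k).θ - (ξ (k - 1)).θ‖ ^ 2
      ≤ (1 - S.δmax)⁻¹ * decrement S ξ k := by
  rw [le_inv_mul_iff₀ (sub_pos.2 S.δmax_lt_one)]
  exact theta_le_decrement k

theorem norm_sq_le_L_mul (k : ℕ) {a : ℝ} (ha : 0 ≤ a) :
    a ≤ S.μθMax * S.γ * (S.L k * a) := by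
  have := mul_le_mul_of_nonneg_right (S.one_le_mul_L k) ha
  linarith

theorem tendsto_theta_diff (hξ : S.IsGenerated ξ) :
    Tendsto (fun k => (ξ k).θ - (ξ (k + 1)).θ) atTop (𝓝 0) := by
  have hγ : 0 < (S.γ - 1) / 4 := by linarith [S.one_lt_γ]
  refine tendsto_zero_of_norm_sq_le
    (S.μθMax * S.γ * (((S.γ - 1) / 4)⁻¹ * (1 - S.δmax)⁻¹))
    ((tendsto_add_atTop_iff_nat 1).2 hξ.tendsto_decrement) fun k => ?_
  have h := L_mul_norm_sq_theta_le (S := S) (ξ := ξ) (k + 1)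
  rw [Nat.add_sub_cancel, norm_sub_rev, mul_assoc, ← le_inv_mul_iff₀ hγ] at h
  refine (norm_sq_le_L_mul (S := S) (k + 1) (sq_nonneg _)).trans ?_
  have hc := mul_pos S.μθMax_pos S.γ_pos
  have := mul_le_mul_of_nonneg_left h hc.le
  linarith

theorem tendsto_hat_sub (hξ : S.IsGenerated ξ) :
    Tendsto (fun k => S.hat ξ k - (ξ k).θ) atTop (𝓝 0) := by
  have hγ : 0 < (S.γ + 1) ^ 2 / (S.γ - 1) := by
    have : 0 < S.γ - 1 := by linarith [S.one_lt_γ]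
    have := S.γ_pos
    positivity
  refine tendsto_zero_of_norm_sq_le
    (S.μθMax * S.γ * (((S.γ + 1) ^ 2 / (S.γ - 1))⁻¹ * (1 - S.δmax)⁻¹))
    hξ.tendsto_decrement fun k => ?_
  have h := (S.norm_sq_hat_sub_le ξ k).trans ((mul_le_of_le_one_left (theta_term_nonneg S ξ k)
    S.δmax_lt_one.le).trans (L_mul_norm_sq_theta_le k))
  rw [← le_inv_mul_iff₀ hγ] at h
  refine (norm_sq_le_L_mul (S := S) (k + 1) (sq_nonneg _)).trans ?_
  have hc := mul_pos S.μθMax_pos S.γ_pos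
  have := mul_le_mul_of_nonneg_left h hc.le
  linarith

/-! ### Passage to the limit along a convergent subsequence -/

section LimitPoint

variable {x : State l n d} {φ : ℕ → ℕ}

/-- The limit of proximal gradient steps on a quadratic block satisfies the first-order optimality
condition. -/
theorem limit_variational {E : Type*} [NormedAddCommGroup E] [InnerProductSpace ℝ E] {r : E → ℝ}
    (hr : Continuous r) {a b z : ℕ → E} {σ : ℕ → ℝ} {σ₀ : ℝ} (hσ₀ : 0 < σ₀) (hσ : ∀ m, σ₀ ≤ σ m)
    {c : ℝ} {a₀ z₀ u : E} (ha : Tendsto a atTop (𝓝 a₀))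
    (hab : Tendsto (fun m => a m - b m) atTop (𝓝 0)) (hz : Tendsto z atTop (𝓝 z₀))
    (h : ∀ m, r (b m) + inner ℝ (a m - σ m • (c • (a m - z m)) - b m) (u - b m) / σ m ≤ r u) :
    r a₀ - inner ℝ (c • (a₀ - z₀)) (u - a₀) ≤ r u := by
  have hb : Tendsto b atTop (𝓝 a₀) := by
    have := ha.sub hab
    simpa using this
  -- The step sizes need not converge; the lower bound `σ₀` is enough.
  have hd : Tendsto (fun m => (σ m)⁻¹ • (a m - b m)) atTop (𝓝 0) := by
    refine squeeze_zero_norm (a := fun m => σ₀⁻¹ * ‖a m - b m‖) (fun m => ?_) ?_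
    · have hpos : 0 < σ m := hσ₀.trans_le (hσ m)
      rw [norm_smul, Real.norm_of_nonneg (inv_pos.2 hpos).le]
      exact mul_le_mul_of_nonneg_right (inv_anti₀ hσ₀ (hσ m)) (norm_nonneg _)
    · simpa using hab.norm.const_mul σ₀⁻¹
  have hlim : Tendsto (fun m => r (b m) + inner ℝ ((σ m)⁻¹ • (a m - b m) - c • (a m - z m))
      (u - b m)) atTop (𝓝 (r a₀ + inner ℝ (0 - c • (a₀ - z₀)) (u - a₀))) :=
    ((hr.tendsto a₀).comp hb).add
      ((hd.sub ((ha.sub hz).const_smul c)).inner (tendsto_const_nhds.sub hb))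
  rw [zero_sub, inner_neg_left, ← sub_eq_add_neg] at hlim
  refine le_of_tendsto' hlim fun m => le_trans (le_of_eq ?_) (h m)
  have hpos : σ m ≠ 0 := (hσ₀.trans_le (hσ m)).ne'
  have e : a m - σ m • (c • (a m - z m)) - b m
      = σ m • ((σ m)⁻¹ • (a m - b m) - c • (a m - z m)) := by
    rw [smul_sub (σ m) ((σ m)⁻¹ • (a m - b m)), smul_inv_smul₀ hpos]
    abel
  rw [e, inner_smul_left, RCLike.conj_to_real, mul_div_cancel_left₀ _ hpos]

theorem eventually_theta_mem_box (hξ : S.IsGenerated ξ) (hφ : StrictMono φ) :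
    ∀ᶠ m in atTop, (ξ (φ m)).θ ∈ P.box := by
  filter_upwards [hφ.tendsto_atTop.eventually_ge_atTop 1] with m hm
  obtain ⟨k, hk⟩ := Nat.exists_eq_add_of_le' hm
  rw [hk]
  exact hξ.theta_mem_box k

theorem limit_theta_mem_box (hξ : S.IsGenerated ξ) (hφ : StrictMono φ)
    (hx : Tendsto (fun m => ξ (φ m)) atTop (𝓝 x)) : x.θ ∈ P.box :=
  P.isClosed_box.mem_of_tendsto ((continuous_θ.tendsto x).comp hx)
    (hξ.eventually_theta_mem_box hφ)

/-- The increment of each block tends to zero, so a shift by one epoch does not change the limit. -/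
theorem tendsto_succ (hξ : S.IsGenerated ξ) (hφ : StrictMono φ)
    (hx : Tendsto (fun m => ξ (φ m)) atTop (𝓝 x)) :
    Tendsto (fun m => ξ (φ m + 1)) atTop (𝓝 x) := by
  have hsub : ∀ {E : Type} [NormedAddCommGroup E] (f : State l n d → E), Continuous f →
      Tendsto (fun k => f (ξ k) - f (ξ (k + 1))) atTop (𝓝 0) →
      Tendsto (fun m => f (ξ (φ m + 1))) atTop (𝓝 (f x)) := by
    intro E _ f hf h
    have := ((hf.tendsto x).comp hx).sub (h.comp hφ.tendsto_atTop)
    simpa only [Function.comp_def, sub_sub_cancel, sub_zero] using this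
  have hh : Tendsto (fun m => (ξ (φ m + 1)).fst) atTop (𝓝 x.fst) :=
    ((PiLp.continuous_toLp 2 _).tendsto _).comp (tendsto_pi_nhds.2 fun q =>
      ((PiLp.continuous_toLp 2 _).tendsto _).comp (tendsto_pi_nhds.2 fun i =>
        hsub (fun x => x.h q i) (continuous_h q i) (hξ.tendsto_h_diff q i)))
  have hV : Tendsto (fun m => (ξ (φ m + 1)).snd.fst) atTop (𝓝 x.snd.fst) :=
    ((PiLp.continuous_toLp 2 _).tendsto _).comp (tendsto_pi_nhds.2 fun j =>
      hsub (fun x => x.V j) (continuous_V j) (hξ.tendsto_V_diff j))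
  have hθ := hsub (fun x => x.θ) continuous_θ hξ.tendsto_theta_diff
  exact ((WithLp.prod_continuous_toLp 2 _ _).tendsto _).comp (hh.prodMk_nhds
    (((WithLp.prod_continuous_toLp 2 _ _).tendsto _).comp (hV.prodMk_nhds hθ)))

/-- Limit of the optimality condition of the `θ`-steps. -/
theorem limit_theta_variational (hξ : S.IsGenerated ξ) (hφ : StrictMono φ)
    (hx : Tendsto (fun m => ξ (φ m)) atTop (𝓝 x)) {u : ThetaSpace l d} (hu : u ∈ P.box) :
    0 ≤ inner ℝ (gradient (fun u => P.g x.h x.V u) x.θ) (u - x.θ) := by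
  have hθ : Tendsto (fun m => (ξ (φ m)).θ) atTop (𝓝 x.θ) := (continuous_θ.tendsto x).comp hx
  have hsucc := hξ.tendsto_succ hφ hx
  have hθ' : Tendsto (fun m => (ξ (φ m + 1)).θ) atTop (𝓝 x.θ) :=
    (continuous_θ.tendsto x).comp hsucc
  have hhat : Tendsto (fun m => S.hat ξ (φ m)) atTop (𝓝 x.θ) := by
    have := (hξ.tendsto_hat_sub.comp hφ.tendsto_atTop).add hθ
    simpa using this
  have hgrad : Tendsto (fun m => gradθ P ξ (φ m) (S.hat ξ (φ m))) atTop
      (𝓝 (gradient (fun u => P.g x.h x.V u) x.θ)) := by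
    have h := (P.continuous_gradient_g_theta.tendsto (x, x.θ)).comp (hsucc.prodMk_nhds hhat)
    simpa only [Function.comp_def, gradθ] using h
  -- The projection inequality divided by the step size; Cauchy–Schwarz bounds the displacement
  -- term, which vanishes in the limit.
  have key : ∀ m, S.μθMin⁻¹ * -(‖S.hat ξ (φ m) - (ξ (φ m + 1)).θ‖ * ‖u - (ξ (φ m + 1)).θ‖)
      ≤ inner ℝ (gradθ P ξ (φ m) (S.hat ξ (φ m))) (u - (ξ (φ m + 1)).θ) := by
    intro m
    have h := hξ.theta_variational (φ m) hu
    have hμ := S.μθ_pos (φ m + 1)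
    set G := gradθ P ξ (φ m) (S.hat ξ (φ m))
    set t := (ξ (φ m + 1)).θ
    have e : S.hat ξ (φ m) - S.μθ (φ m + 1) • G - t
        = (S.hat ξ (φ m) - t) - S.μθ (φ m + 1) • G := by abel
    rw [e, inner_sub_left, inner_smul_left, RCLike.conj_to_real, sub_nonpos,
      ← inv_mul_le_iff₀ hμ] at h
    refine le_trans ?_ h
    have h1 := neg_le_of_abs_le (abs_real_inner_le_norm (S.hat ξ (φ m) - t) (u - t))
    have h2 : (S.μθ (φ m + 1))⁻¹ ≤ S.μθMin⁻¹ := inv_anti₀ S.μθMin_pos (S.μθ_mem (φ m + 1)).1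
    have h3 := mul_le_mul_of_nonneg_left h1 (inv_pos.2 hμ).le
    have h4 := mul_le_mul_of_nonneg_right h2
      (mul_nonneg (norm_nonneg (S.hat ξ (φ m) - t)) (norm_nonneg (u - t)))
    linarith
  have hleft : Tendsto (fun m => S.μθMin⁻¹ *
      -(‖S.hat ξ (φ m) - (ξ (φ m + 1)).θ‖ * ‖u - (ξ (φ m + 1)).θ‖)) atTop (𝓝 0) := by
    have := (((hhat.sub hθ').norm.mul (tendsto_const_nhds (x := u) |>.sub hθ').norm).neg).const_mul
      S.μθMin⁻¹
    simpa using this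
  exact le_of_tendsto_of_tendsto' hleft (hgrad.inner (tendsto_const_nhds.sub hθ')) key

theorem isCriticalPt_limit (hξ : S.IsGenerated ξ) (hφ : StrictMono φ)
    (hx : Tendsto (fun m => ξ (φ m)) atTop (𝓝 x)) : IsCriticalPt P.Q x := by
  refine P.isCriticalPt_of_blockwise (fun q i u => ?_) (fun j U => ?_)
    (hξ.limit_theta_mem_box hφ hx) fun u hu => hξ.limit_theta_variational hφ hx hu
  · exact limit_variational (P.continuous_rh i) (S.shMin_pos i)
      (fun m => (S.sh_mem (φ m + 1) i).1) (((continuous_h q i).tendsto x).comp hx)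
      ((hξ.tendsto_h_diff q i).comp hφ.tendsto_atTop)
      ((((P.contDiff_z q i).continuous.comp continuous_θ).tendsto x).comp hx)
      fun m => hξ.h_variational (φ m) q i u
  · have hW : Continuous fun x : State l n d => x.θ.fst j := by fun_prop
    exact limit_variational (P.continuous_rv j) (S.svMin_pos j)
      (fun m => (S.sv_mem (φ m + 1) j).1) (((continuous_V j).tendsto x).comp hx)
      ((hξ.tendsto_V_diff j).comp hφ.tendsto_atTop) ((hW.tendsto x).comp hx)
      fun m => hξ.V_variational (φ m) j U

end LimitPoint

end IsGenerated

end StepRule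

end Model

end DNNNSR

end

theorem theorem1 {l n : ℕ} {d : Fin (l + 2) → ℕ} (P : DNNNSR.Model l n d)
    (S : DNNNSR.StepRule P) (ξ : ℕ → DNNNSR.State l n d) (hξ : S.IsGenerated ξ)
    (hbdd : Bornology.IsBounded (Set.range ξ)) :
    -- (a) a limit point exists
    (∃ (x : DNNNSR.State l n d) (φ : ℕ → ℕ), StrictMono φ ∧
      Filter.Tendsto (fun m => ξ (φ m)) Filter.atTop (nhds x)) ∧
    -- (b) the regularizers converge along every convergent subsequence
    (∀ (x : DNNNSR.State l n d) (φ : ℕ → ℕ), StrictMono φ →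
      Filter.Tendsto (fun m => ξ (φ m)) Filter.atTop (nhds x) →
      (∀ q i, Filter.Tendsto (fun m => P.rh i ((ξ (φ m)).h q i)) Filter.atTop
        (nhds (P.rh i (x.h q i)))) ∧
      (∀ j, Filter.Tendsto (fun m => P.rv j ((ξ (φ m)).V j)) Filter.atTop
        (nhds (P.rv j (x.V j)))) ∧
      Filter.Tendsto (fun m => P.rθ (ξ (φ m)).θ) Filter.atTop (nhds (P.rθ x.θ))) ∧
    -- (c) every limit point is a critical point
    (∀ (x : DNNNSR.State l n d) (φ : ℕ → ℕ), StrictMono φ →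
      Filter.Tendsto (fun m => ξ (φ m)) Filter.atTop (nhds x) →
      DNNNSR.IsCriticalPt P.Q x) ∧
    -- (d) the objective converges along every convergent subsequence
    (∀ (x : DNNNSR.State l n d) (φ : ℕ → ℕ), StrictMono φ →
      Filter.Tendsto (fun m => ξ (φ m)) Filter.atTop (nhds x) →
      Filter.Tendsto (fun m => P.Q (ξ (φ m))) Filter.atTop (nhds (P.Q x))) := by
  refine ⟨?_, fun x φ hφ hx => ⟨fun q i => ?_, fun j => ?_, ?_⟩,
    fun x φ hφ hx => hξ.isCriticalPt_limit hφ hx, fun x φ hφ hx => ?_⟩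
  · obtain ⟨x, -, φ, hφ, hx⟩ := tendsto_subseq_of_bounded hbdd fun k => Set.mem_range_self k
    exact ⟨x, φ, hφ, hx⟩
  · exact (((P.continuous_rh i).comp (DNNNSR.continuous_h q i)).tendsto x).comp hx
  · exact (((P.continuous_rv j).comp (DNNNSR.continuous_V j)).tendsto x).comp hx
  -- `rθ` is discontinuous at the boundary of the box, but all iterates after the initial one and
  -- the limit lie in the box, where it is zero.
  · rw [P.rθ_of_mem (hξ.limit_theta_mem_box hφ hx)]
    refine tendsto_const_nhds.congr' ?_
    filter_upwards [hξ.eventually_theta_mem_box hφ] with m hm using (P.rθ_of_mem hm).symm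
  · rw [P.Q_of_mem (hξ.limit_theta_mem_box hφ hx)]
    refine ((continuous_coe_real_ereal.tendsto _).comp
      ((P.continuous_finitePart.tendsto x).comp hx)).congr' ?_
    filter_upwards [hξ.eventually_theta_mem_box hφ] with m hm using (P.Q_of_mem hm).symm
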